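/- **Conventions.** A metric measure space $(X,\mathsf d,\mathfrak m)$ is a complete separable metric space $(X,\mathsf d)$ with a nonnegative Borel measure $\mathfrak m$ that is finite on bounded sets. A pointed metric measure space $(X,\mathsf d,\mathfrak m,\bar x)$ has in addition a reference point $\bar x\in\operatorname{supp}\mathfrak m$. $B_R(x)$ is the open ball. *Convergence.* Pointed metric measure spaces $(X_i,\mathsf d_i,\mathfrak m_i,\bar x_i)$ converge to $(X_\infty,\mathsf d_\infty,\mathfrak m_\infty,\bar x_\infty)$ in the pointed measured Gromov–Hausdorff sense if there are a separable metric space $(Z,\mathsf d_Z)$ and isometric embeddings $\iota_i:(\operatorname{supp}\mathfrak m_i,\mathsf d_i)\to Z$, $i\in\mathbb N\cup\{\infty\}$, such that (a) for all $\varepsilon,R>0$ there is $i_0$ such that for all $i>i_0$ the set $\iota_\infty(B_R(\bar x_\infty))$ is contained in the open $\varepsilon$-neighbourhood of $\iota_i(B_R(\bar x_i))$ and $\iota_i(B_R(\bar x_i))$ is contained in the open $\varepsilon$-neighbourhood of $\iota_\infty(B_R(\bar x_\infty))$, the balls being taken in the supports; and (b) $\int_Z\varphi\,d(\iota_i)_\sharp\mathfrak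 m_i\to\int_Z\varphi\,d(\iota_\infty)_\sharp\mathfrak m_\infty$ for every bounded continuous $\varphi:Z\to\mathbb R$ with bounded support. *Tangents.* For $x\in\operatorname{supp}\mathfrak m$ and $r>0$ put $$\mathfrak m^x_r:=\Big(\int_{B_r(x)}\big(1-\tfrac1r\,\mathsf d(\cdot,x)\big)\,d\mathfrak m\Big)^{-1}\mathfrak m .$$ $\mathrm{Tan}(X,\mathsf d,\mathfrak m,x)$ is the collection of all pointed metric measure spaces $(Y,\mathsf d_Y,\mathfrak n,y)$ for which there are radii $r_i\in(0,1)$, $r_i\downarrow0$, such that $(X,r_i^{-1}\mathsf d,\mathfrak m^x_{r_i},x)\to(Y,\mathsf d_Y,\mathfrak n,y)$ in the pointed measured Gromov–Hausdorff sense. **Theorem 3.2 (Tangents of tangents are tangents).** Let $(X,\mathsf d,\mathfrak m)$ be a metric measure space that is boundedly doubling: for some $C:(0,\infty)\to(0,\infty)$, $$0<\mathfrak m(B_{2r}(x))\le C(R)\,\mathfrak m(B_r(x))\qquad\text{for all }x\in X,\ 0<r\le R .$$ Then for $\mathfrak m$-a.e. $x\in X$ the following holds: for every $(Y,\mathsf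 d_Y,\mathfrak n,y)\in\mathrm{Tan}(X,\mathsf d,\mathfrak m,x)$ and every $y'\in\operatorname{supp}\mathfrak n$, $$\mathrm{Tan}(Y,\mathsf d_Y,\mathfrak n^{y'}_1,y')\subset\mathrm{Tan}(X,\mathsf d,\mathfrak m,x).$$ -/

import Mathlib

open Filter Topology MeasureTheory Set

universe u v w

noncomputable section

/-- A metric measure space `(X, d, m)`: a complete separable metric space with a nonnegative Borel
measure that is finite on bounded sets. -/
structure MMSpace where
  /-- the underlying set `X` -/
  carrier : Type u
  [metric : MetricSpace carrier]
  [complete : CompleteSpace carrier]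
  [separable : TopologicalSpace.SeparableSpace carrier]
  [measurable : MeasurableSpace carrier]
  [borel : BorelSpace carrier]
  /-- the reference measure `m` -/
  measure : Measure carrier
  finite_of_isBounded : ∀ s : Set carrier, Bornology.IsBounded s → measure s < ⊤

namespace MMSpace

instance : CoeSort MMSpace.{u} (Type u) := ⟨MMSpace.carrier⟩

attribute [instance] metric complete separable measurable borel

/-- The support of the reference measure. -/
def supp (X : MMSpace.{u}) : Set X := X.measure.support

/-- The measure of the space is boundedly doubling with constants `C(R)`:
`0 < m(B_{2r}(x)) ≤ C(R) m(B_r(x))` for all `x` and all `0 < r ≤ R`. -/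
def IsBoundedlyDoubling (X : MMSpace.{u}) (C : ℝ → ℝ) : Prop :=
  ∀ (x : X) (r R : ℝ), 0 < r → r ≤ R →
    0 < X.measure (Metric.ball x (2 * r)) ∧
      X.measure (Metric.ball x (2 * r)) ≤ ENNReal.ofReal (C R) * X.measure (Metric.ball x r)

/-- `∫_{B_r(x)} (1 - d(·, x) / r) dm`, as the lower integral of a function that is nonnegative
on the ball. -/
def normConst (X : MMSpace.{u}) (x : X) (r : ℝ) : ENNReal :=
  ∫⁻ z in Metric.ball x r, ENNReal.ofReal (1 - dist z x / r) ∂X.measure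

theorem normConst_ne_zero (X : MMSpace.{u}) {x : X} (hx : x ∈ X.supp) {r : ℝ} (hr : 0 < r) :
    X.normConst x r ≠ 0 := by
  have hpos : 0 < X.measure (Metric.ball x (r / 2)) :=
    (Measure.mem_support_iff_forall x).1 hx _ (Metric.ball_mem_nhds x (half_pos hr))
  have hle : ENNReal.ofReal (1 / 2) * X.measure (Metric.ball x (r / 2)) ≤ X.normConst x r := by
    calc ENNReal.ofReal (1 / 2) * X.measure (Metric.ball x (r / 2))
        = ∫⁻ _ in Metric.ball x (r / 2), ENNReal.ofReal (1 / 2) ∂X.measure := by simp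
      _ ≤ ∫⁻ z in Metric.ball x (r / 2), ENNReal.ofReal (1 - dist z x / r) ∂X.measure := by
          refine setLIntegral_mono' Metric.isOpen_ball.measurableSet fun z hz => ?_
          refine ENNReal.ofReal_le_ofReal ?_
          have hz' : dist z x < r / 2 := hz
          have : dist z x / r ≤ 1 / 2 := by
            rw [div_le_iff₀ hr]; linarith
          linarith
      _ ≤ X.normConst x r :=
          lintegral_mono_set (Metric.ball_subset_ball (by linarith))
  have h2 : 0 < ENNReal.ofReal (1 / 2) * X.measure (Metric.ball x (r / 2)) :=
    ENNReal.mul_pos (by simp) hpos.ne'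
  exact (h2.trans_le hle).ne'

/-- The space `(X, d, m_r^x)`, where `m_r^x = (∫_{B_r(x)} (1 - d(·, x) / r) dm)⁻¹ m`, for `x` in
the support of `m`. -/
def normalize (X : MMSpace.{u}) (x : X) (hx : x ∈ X.supp) (r : ℝ) (hr : 0 < r) :
    MMSpace.{u} where
  carrier := X
  measure := (X.normConst x r)⁻¹ • X.measure
  finite_of_isBounded s hs := by
    rw [Measure.smul_apply, smul_eq_mul]
    exact ENNReal.mul_lt_top
      (ENNReal.inv_lt_top.2 (pos_iff_ne_zero.2 (X.normConst_ne_zero hx hr)))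
      (X.finite_of_isBounded s hs)

end MMSpace

/-- The metric `r⁻¹ d` on a metric space `(X, d)`, for `r > 0`. It induces the same uniformity and
the same bounded sets. -/
abbrev dilatedMetric (X : Type u) [d : MetricSpace X] (r : ℝ) (hr : 0 < r) : MetricSpace X where
  dist a b := r⁻¹ * dist a b
  dist_self a := by simp
  dist_comm a b := by rw [dist_comm]
  dist_triangle a b c := by
    rw [← mul_add]
    exact mul_le_mul_of_nonneg_left (dist_triangle a b c) (inv_pos.2 hr).le
  eq_of_dist_eq_zero {a b} h := by
    rcases mul_eq_zero.1 h with h | h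
    · exact absurd h (inv_pos.2 hr).ne'
    · exact dist_eq_zero.1 h
  toUniformSpace := d.toUniformSpace
  uniformity_dist := by
    refine Metric.uniformity_basis_dist.eq_biInf.trans (le_antisymm ?_ ?_)
    · refine le_iInf₂ fun ε hε => iInf₂_le_of_le (r * ε) (mul_pos hr hε) ?_
      refine principal_mono.2 fun p hp => ?_
      have hp' : dist p.1 p.2 < r * ε := hp
      exact (inv_mul_lt_iff₀ hr).2 hp'
    · refine le_iInf₂ fun ε hε => iInf₂_le_of_le (r⁻¹ * ε) (mul_pos (inv_pos.2 hr) hε) ?_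
      refine principal_mono.2 fun p hp => ?_
      exact lt_of_mul_lt_mul_left (show r⁻¹ * dist p.1 p.2 < r⁻¹ * ε from hp) (inv_pos.2 hr).le
  toBornology := d.toBornology
  cobounded_sets := by
    rw [d.cobounded_sets]
    ext s
    constructor
    · rintro ⟨C, hC⟩
      exact ⟨r⁻¹ * C, fun x hx y hy =>
        mul_le_mul_of_nonneg_left (hC x hx y hy) (inv_pos.2 hr).le⟩
    · rintro ⟨C, hC⟩
      exact ⟨r * C, fun x hx y hy => (inv_mul_le_iff₀ hr).1 (hC x hx y hy)⟩

namespace MMSpace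

/-- The space `(X, r⁻¹ d, m)`. -/
def dilate (X : MMSpace.{u}) (r : ℝ) (hr : 0 < r) : MMSpace.{u} where
  carrier := X
  metric := dilatedMetric X r hr
  complete := X.complete
  separable := X.separable
  measurable := X.measurable
  borel := X.borel
  measure := X.measure
  finite_of_isBounded := X.finite_of_isBounded

theorem supp_normalize (X : MMSpace.{u}) (x : X) (hx : x ∈ X.supp) (r : ℝ) (hr : 0 < r) :
    (X.normalize x hx r hr).supp = X.supp := by
  have hfin : X.normConst x r ≠ ⊤ := by
    refine ne_top_of_le_ne_top (X.finite_of_isBounded _ (Metric.isBounded_ball (x := x) (r := r))).ne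
      ((setLIntegral_mono' (g := fun _ => 1) Metric.isOpen_ball.measurableSet fun z _ => ?_).trans
        (by simp))
    refine ENNReal.ofReal_le_one.2 ?_
    have : 0 ≤ dist z x / r := by positivity
    linarith
  have hc : (X.normConst x r)⁻¹ ≠ 0 := ENNReal.inv_ne_zero.2 hfin
  have key : ((X.normConst x r)⁻¹ • X.measure).support = X.measure.support := by
    ext z
    simp only [Measure.mem_support_iff_forall, Measure.smul_apply, smul_eq_mul, pos_iff_ne_zero,
      mul_ne_zero_iff, ne_eq, hc, not_false_eq_true, true_and]
  exact key

end MMSpace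

/-- A pointed metric measure space `(X, d, m, x̄)`, with reference point `x̄ ∈ supp m`. -/
structure PMMSpace extends MMSpace.{u} where
  /-- the reference point -/
  pt : toMMSpace
  pt_mem_supp : pt ∈ toMMSpace.supp

namespace PMMSpace

/-- The reference point, as a point of the support. -/
def base (X : PMMSpace.{u}) : X.supp := ⟨X.pt, X.pt_mem_supp⟩

/-- The push-forward of the reference measure of `X` under a map defined on its support (the
complement of the support being a null set). -/
def pushforward (X : PMMSpace.{u}) {Z : Type w} [MeasurableSpace Z] (ι : X.supp → Z) :
    Measure Z :=
  (X.measure.comap (Subtype.val : X.supp → X.toMMSpace)).map ι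

/-- Pointed measured Gromov-Hausdorff convergence of `X i` to `Y`: there are a separable metric
space `Z` and isometric embeddings of the supports of all these spaces into `Z`, such that the
images of balls around the reference points converge in the sense of the two inclusions below, and
the push-forward measures converge weakly against bounded continuous functions of bounded support.
(Every separable metric space is isometric to one in `Type`, so that the universe of `Z` is no
restriction.) -/
def Converges (X : ℕ → PMMSpace.{u}) (Y : PMMSpace.{v}) : Prop :=
  ∃ (Z : Type) (_ : MetricSpace Z) (_ : TopologicalSpace.SeparableSpace Z)
    (_ : MeasurableSpace Z) (_ : BorelSpace Z)
    (ι : ∀ i, (X i).supp → Z) (ι' : Y.supp → Z),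
    (∀ i, Isometry (ι i)) ∧ Isometry ι' ∧
    (∀ ε : ℝ, 0 < ε → ∀ R : ℝ, 0 < R → ∃ i₀ : ℕ, ∀ i, i₀ < i →
      ι' '' Metric.ball Y.base R ⊆ Metric.thickening ε (ι i '' Metric.ball (X i).base R) ∧
      ι i '' Metric.ball (X i).base R ⊆ Metric.thickening ε (ι' '' Metric.ball Y.base R)) ∧
    ∀ φ : Z → ℝ, Continuous φ → (∃ M : ℝ, ∀ z, |φ z| ≤ M) →
      Bornology.IsBounded (Function.support φ) →
      Tendsto (fun i => ∫ z, φ z ∂((X i).pushforward (ι i))) atTop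
        (𝓝 (∫ z, φ z ∂(Y.pushforward ι')))

end PMMSpace

namespace MMSpace

/-- The rescaled pointed space `(X, r⁻¹ d, m_r^x, x)`. -/
def rescale (X : MMSpace.{u}) (x : X) (hx : x ∈ X.supp) (r : ℝ) (hr : 0 < r) :
    PMMSpace.{u} where
  toMMSpace := (X.normalize x hx r hr).dilate r hr
  pt := x
  pt_mem_supp := (X.supp_normalize x hx r hr).symm ▸ hx

/-- The pointed space `Y` belongs to `Tan(X, d, m, x)`: `x ∈ supp m` and there are radii
`r_i ∈ (0, 1)`, `r_i ↓ 0`, such that `(X, r_i⁻¹ d, m_{r_i}^x, x)` converges to `Y`. -/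
def IsTangent (X : MMSpace.{u}) (x : X) (Y : PMMSpace.{v}) : Prop :=
  ∃ (hx : x ∈ X.supp) (r : ℕ → ℝ) (hr : ∀ i, r i ∈ Ioo (0 : ℝ) 1), Antitone r ∧ Tendsto r atTop (𝓝 0) ∧
    PMMSpace.Converges (fun i => X.rescale x hx (r i) (hr i).1) Y

end MMSpace

end

/-! A code is a triple (N, k, l). It asks for N points, starting at the centre, that form a fine net
of the ball of radius k + 1 and whose mutual distances and cap masses lie near the l-th element of a
dense sequence. There are only countably many codes, and they replace a separable metric on the
class of pointed spaces. They are open: a code realized in a limit is eventually realized along the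
sequence, around any points converging to the centre (`ConvergesVia.eventually_sat`). They also
detect tangents: a normalized space with totally bounded balls, all of whose codes occur around x at
arbitrarily small scales, is a tangent at x (`isTangent_of_forall_sat`).

Fix a code and m, and let A be the set of points x around which the code fails at all scales below 1
/ (m + 1), although some tangent at x realizes it around some point y. If x ∈ A were a density point
of A, then y would be a limit of points of A, and by openness the code would be realized around
points of A at scales tending to 0, a contradiction. Doubling provides the density theorem, so A is
null (`measure_badSet`). Outside the countable union of these sets, a code of a tangent W of a
tangent Y at y' is, by openness, realized in Y around y', hence in X around x at arbitrarily small
scales (`ae_exists_sat`).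

To recover W as a tangent at x, take for each k a code of precision k realized by W. Its
realizations around x yield nets in rescalings of X that match nets of W. The spaces are glued along
these nets (`exists_common_space`), and integrals are compared through weighted sums over the nets
(`NetApprox.abs_integral_sub_le`). W is stretched by a factor tending to 1 so that open balls of
equal radius correspond. -/

noncomputable section

/-! ### Cut-offs around finite nets -/

/-- A continuous cut-off equal to `1` for `t ≤ ε` and to `0` for `2 ε ≤ t`. -/
def tent (ε t : ℝ) : ℝ := max 0 (min 1 (2 - t / ε))

theorem tent_nonneg (ε t : ℝ) : 0 ≤ tent ε t := le_max_left _ _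

theorem tent_le_one (ε t : ℝ) : tent ε t ≤ 1 := max_le zero_le_one (min_le_left _ _)

theorem tent_eq_one {ε t : ℝ} (hε : 0 < ε) (h : t ≤ ε) : tent ε t = 1 := by
  have : t / ε ≤ 1 := (div_le_one hε).2 h
  rw [tent, min_eq_left (by linarith), max_eq_right zero_le_one]

theorem lt_of_tent_ne_zero {ε t : ℝ} (hε : 0 < ε) (h : tent ε t ≠ 0) : t < 2 * ε := by
  by_contra! hc
  have : 2 ≤ t / ε := (le_div_iff₀ hε).2 hc
  exact h (max_eq_left ((min_le_right _ _).trans (by linarith)))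

theorem continuous_tent (ε : ℝ) : Continuous (tent ε) := by
  unfold tent; fun_prop

theorem abs_tent_sub_tent_le {ε : ℝ} (hε : 0 < ε) (t t' : ℝ) :
    |tent ε t - tent ε t'| ≤ |t - t'| / ε := by
  have h1 : |tent ε t - tent ε t'| ≤ |min 1 (2 - t / ε) - min 1 (2 - t' / ε)| := by
    have := abs_max_sub_max_le_max 0 (min 1 (2 - t / ε)) 0 (min 1 (2 - t' / ε))
    simpa [tent] using this
  have h2 : |min 1 (2 - t / ε) - min 1 (2 - t' / ε)| ≤ |(2 - t / ε) - (2 - t' / ε)| := by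
    have := abs_min_sub_min_le_max 1 (2 - t / ε) 1 (2 - t' / ε)
    simpa using this
  refine h1.trans (h2.trans (le_of_eq ?_))
  rw [show (2 - t / ε) - (2 - t' / ε) = -((t - t') / ε) by ring, abs_neg, abs_div, abs_of_pos hε]

/-- The maximum of the cut-offs at scale `ε` around the first `j` points of a sequence. -/
def cap {E : Type*} (ε : ℝ) (d : E → E → ℝ) (p : ℕ → E) : ℕ → E → ℝ
  | 0 => fun _ => 0
  | j + 1 => fun z => max (cap ε d p j z) (tent ε (d z (p j)))

section cap

variable {E : Type*} {ε : ℝ} {d : E → E → ℝ} {p : ℕ → E}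

theorem cap_nonneg (j : ℕ) (z : E) : 0 ≤ cap ε d p j z := by
  cases j with
  | zero => exact le_rfl
  | succ j => exact (tent_nonneg _ _).trans (le_max_right _ _)

theorem cap_le_one (j : ℕ) (z : E) : cap ε d p j z ≤ 1 := by
  induction j with
  | zero => exact zero_le_one
  | succ j ih => exact max_le ih (tent_le_one _ _)

theorem cap_le_cap_succ (j : ℕ) (z : E) : cap ε d p j z ≤ cap ε d p (j + 1) z := le_max_left _ _

theorem cap_eq_one (hε : 0 < ε) {N : ℕ} {z : E} (h : ∃ j < N, d z (p j) ≤ ε) :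
    cap ε d p N z = 1 := by
  obtain ⟨j, hj, hz⟩ := h
  induction N with
  | zero => omega
  | succ N ih =>
    refine le_antisymm (cap_le_one _ _) ?_
    rcases Nat.lt_succ_iff_lt_or_eq.1 hj with h | rfl
    · exact (ih h).symm.le.trans (le_max_left _ _)
    · exact (tent_eq_one hε hz).symm.le.trans (le_max_right _ _)

/-- The increments of the caps serve as a partition of unity: they are nonnegative, telescope to the
full cap, and the j-th one lives near the j-th point. -/
theorem lt_of_cap_succ_ne (hε : 0 < ε) {j : ℕ} {z : E}
    (h : cap ε d p (j + 1) z - cap ε d p j z ≠ 0) : d z (p j) < 2 * ε := by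
  refine lt_of_tent_ne_zero hε fun h0 => h ?_
  have : cap ε d p (j + 1) z = cap ε d p j z := by
    change max _ _ = _
    rw [h0, max_eq_left (cap_nonneg _ _)]
  rw [this, sub_self]

theorem exists_lt_of_cap_ne_zero (hε : 0 < ε) {N : ℕ} {z : E} (h : cap ε d p N z ≠ 0) :
    ∃ j < N, d z (p j) < 2 * ε := by
  induction N with
  | zero => exact absurd rfl h
  | succ N ih =>
    by_cases h0 : cap ε d p N z = 0
    · exact ⟨N, Nat.lt_succ_self N, lt_of_cap_succ_ne hε (by rwa [h0, sub_zero])⟩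
    · obtain ⟨j, hj, hz⟩ := ih h0
      exact ⟨j, hj.trans (Nat.lt_succ_self N), hz⟩

/-- Maxima are nonexpansive, so only the Lipschitz constant 1 / ε of the cut-off enters. This
controls caps with moving centres. -/
theorem abs_cap_sub_cap_le (hε : 0 < ε) {F : Type*} {d' : F → F → ℝ} {q : ℕ → F} (z : E) (z' : F)
    (N : ℕ) : |cap ε d p N z - cap ε d' q N z'| ≤
      ∑ j ∈ Finset.range N, |d z (p j) - d' z' (q j)| / ε := by
  induction N with
  | zero => simp [cap]
  | succ N ih =>
    rw [Finset.sum_range_succ]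
    refine (abs_max_sub_max_le_max _ _ _ _).trans (max_le ?_ ?_)
    · have : 0 ≤ |d z (p N) - d' z' (q N)| / ε := by positivity
      linarith
    · have := abs_tent_sub_tent_le hε (d z (p N)) (d' z' (q N))
      have : 0 ≤ ∑ j ∈ Finset.range N, |d z (p j) - d' z' (q j)| / ε :=
        Finset.sum_nonneg fun _ _ => by positivity
      linarith

/-- A cap depends only on distances to the centres, so its integral can be computed after an
isometric embedding. -/
theorem cap_congr {F : Type*} {d' : F → F → ℝ} {q : ℕ → F} {z : E} {z' : F}
    (h : ∀ j, d z (p j) = d' z' (q j)) (N : ℕ) : cap ε d p N z = cap ε d' q N z' := by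
  induction N with
  | zero => rfl
  | succ N ih => simp only [cap, ih, h]

theorem continuous_cap [TopologicalSpace E] (h : ∀ j, Continuous fun z => d z (p j)) (N : ℕ) :
    Continuous (cap ε d p N) := by
  induction N with
  | zero => exact continuous_const
  | succ N ih => exact ih.max ((continuous_tent ε).comp (h N))

end cap

/-- The cone `(1 - d(·, b))⁺`. -/
def cone {E : Type*} (d : E → E → ℝ) (b z : E) : ℝ := max 0 (1 - d z b)

theorem cone_nonneg {E : Type*} (d : E → E → ℝ) (b z : E) : 0 ≤ cone d b z := le_max_left _ _

theorem abs_cone_sub_cone_le {E F : Type*} (d : E → E → ℝ) (b z : E) (d' : F → F → ℝ) (b' z' : F) :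
    |cone d b z - cone d' b' z'| ≤ |d z b - d' z' b'| := by
  have := abs_max_sub_max_le_max 0 (1 - d z b) 0 (1 - d' z' b')
  refine this.trans (le_of_eq ?_)
  rw [sub_self, abs_zero, max_eq_right (abs_nonneg _), ← abs_neg]
  congr 1; ring

/-! ### Codes -/

/-- The mesh of a code of precision `k`. -/
def mesh (k : ℕ) : ℝ := 1 / ((k : ℝ) + 1) ^ 4

theorem mesh_pos (k : ℕ) : 0 < mesh k := by unfold mesh; positivity

/-- Mutual distances of `N` points and masses of the caps around them. -/
abbrev NetDataSpace (N : ℕ) : Type := (Fin N → Fin N → ℝ) × (Fin N → ℝ)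

/-- The mutual distances of the first `N` points of a sequence, and the masses of the caps around
them relative to the mass of the unit cone around the initial point. -/
def netData {E : Type*} [MeasurableSpace E] (N k : ℕ) (d : E → E → ℝ) (μ : Measure E)
    (p : ℕ → E) : NetDataSpace N :=
  (fun i j => d (p i) (p j),
    fun j => (∫ z, cap (mesh k) d p (j + 1) z ∂μ) / ∫ z, cone d (p 0) z ∂μ)

/-- The pointed set `(S, b)` with distance `d` and measure `μ` realizes the code `(N, k, l)`: it has
`N` points that form a net of the ball of radius `k + 1`, and whose data are close to the `l`-th
element of a dense sequence. -/
def Realizes (N k l : ℕ) {E : Type*} [MeasurableSpace E] (d : E → E → ℝ) (μ : Measure E)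
    (S : Set E) (b : E) : Prop :=
  ∃ p : ℕ → E, p 0 = b ∧ (∀ j, p j ∈ S) ∧
    (∃ δ > 0, ∀ z ∈ S, d z b < k + 1 + δ → ∃ j < N, d z (p j) < mesh k - δ) ∧
    dist (netData N k d μ p) (TopologicalSpace.denseSeq (NetDataSpace N) l) < mesh k / (N + 1)

/-- Masses enter only as ratios, so codes do not see the normalization of the measure, and those of
a rescaling are codes of the original space at another scale. -/
theorem netData_smul {E : Type*} [MeasurableSpace E] (N k : ℕ) (d : E → E → ℝ) (μ : Measure E)
    (p : ℕ → E) {c : ENNReal} (h0 : c ≠ 0) (ht : c ≠ ⊤) :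
    netData N k d (c • μ) p = netData N k d μ p := by
  have hc : c.toReal ≠ 0 := (ENNReal.toReal_pos h0 ht).ne'
  simp only [netData, integral_smul_measure, smul_eq_mul, mul_div_mul_left _ _ hc]

theorem realizes_smul_iff {N k l : ℕ} {E : Type*} [MeasurableSpace E] {d : E → E → ℝ}
    {μ : Measure E} {S : Set E} {b : E} {c : ENNReal} (h0 : c ≠ 0) (ht : c ≠ ⊤) :
    Realizes N k l d (c • μ) S b ↔ Realizes N k l d μ S b := by
  simp only [Realizes, netData_smul N k d μ _ h0 ht]

namespace MMSpace

/-- The space `X`, dilated by `s⁻¹` around `p`, realizes the code `(N, k, l)`. -/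
def Sat (X : MMSpace.{u}) (N k l : ℕ) (p : X) (s : ℝ) : Prop :=
  Realizes N k l (fun a b : X => s⁻¹ * dist a b) X.measure X.supp p

theorem normConst_ne_top (X : MMSpace.{u}) (x : X) {r : ℝ} (hr : 0 < r) :
    X.normConst x r ≠ ⊤ := by
  refine ne_top_of_le_ne_top (X.finite_of_isBounded _ (Metric.isBounded_ball (x := x) (r := r))).ne
    ((setLIntegral_mono' (g := fun _ => 1) Metric.isOpen_ball.measurableSet fun z _ => ?_).trans
      (by simp))
  refine ENNReal.ofReal_le_one.2 ?_
  have : 0 ≤ dist z x / r := by positivity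
  linarith

theorem sat_normalize_iff (X : MMSpace.{u}) (x : X) (hx : x ∈ X.supp) {r : ℝ} (hr : 0 < r)
    {N k l : ℕ} (p : X) (s : ℝ) :
    (X.normalize x hx r hr).Sat N k l p s ↔ X.Sat N k l p s := by
  unfold Sat
  rw [X.supp_normalize x hx r hr]
  exact realizes_smul_iff (ENNReal.inv_ne_zero.2 (X.normConst_ne_top x hr))
    (ENNReal.inv_ne_top.2 (X.normConst_ne_zero hx hr))

theorem sat_dilate_iff (X : MMSpace.{u}) {r : ℝ} (hr : 0 < r) {N k l : ℕ} (p : X) (s : ℝ) :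
    (X.dilate r hr).Sat N k l p s ↔ X.Sat N k l p (r * s) := by
  have : (fun a b : X => (r * s)⁻¹ * dist a b) = fun a b => s⁻¹ * (r⁻¹ * dist a b) := by
    funext a b; rw [mul_inv]; ring
  unfold Sat
  rw [this]
  exact Iff.rfl

theorem sat_rescale_iff (X : MMSpace.{u}) (x : X) (hx : x ∈ X.supp) {r : ℝ} (hr : 0 < r)
    {N k l : ℕ} (p : X) (s : ℝ) :
    (X.rescale x hx r hr).toMMSpace.Sat N k l p s ↔ X.Sat N k l p (r * s) :=
  ((X.normalize x hx r hr).sat_dilate_iff hr p s).trans (X.sat_normalize_iff x hx hr p (r * s))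

/-! ### Passage to the support -/

/-- The reference measure as a measure on the support. -/
def suppMeasure (X : MMSpace.{u}) : Measure X.supp := X.measure.comap Subtype.val

theorem isClosed_supp (X : MMSpace.{u}) : IsClosed X.supp := Measure.isClosed_support

theorem measure_compl_supp (X : MMSpace.{u}) : X.measure X.suppᶜ = 0 := by
  have := UniformSpace.secondCountable_of_separable X.carrier
  exact Measure.measure_compl_support

theorem integral_suppMeasure (X : MMSpace.{u}) (g : X → ℝ) :
    ∫ z : X.supp, g z ∂X.suppMeasure = ∫ z, g z ∂X.measure := by
  rw [suppMeasure, integral_subtype_comap X.isClosed_supp.measurableSet]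
  congr 1
  exact Measure.restrict_eq_self_of_ae_mem (by
    rw [ae_iff]; exact X.measure_compl_supp)

theorem suppMeasure_lt_top (X : MMSpace.{u}) (s : Set X.supp) (hs : Bornology.IsBounded s) :
    X.suppMeasure s < ⊤ := by
  exact (MeasurableEmbedding.comap_apply
    (MeasurableEmbedding.subtype_coe X.isClosed_supp.measurableSet) _ _).trans_lt
    (X.finite_of_isBounded _ (isometry_subtype_coe.lipschitz.isBounded_image hs))

end MMSpace

/-- A bounded continuous function with bounded support is integrable for a measure that is finite
on bounded sets. -/
theorem integrable_of_isBounded_support {E : Type*} [PseudoMetricSpace E] [MeasurableSpace E]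
    [OpensMeasurableSpace E] {μ : Measure E} (hμ : ∀ s, Bornology.IsBounded s → μ s < ⊤)
    {f : E → ℝ} (hf : Continuous f) {M : ℝ} (hM : ∀ z, |f z| ≤ M)
    (hs : Bornology.IsBounded (Function.support f)) : Integrable f μ := by
  rw [← integrableOn_iff_integrable_of_support_subset (Subset.refl (Function.support f))]
  exact Measure.integrableOn_of_bounded (hμ _ hs).ne hf.measurable.aestronglyMeasurable
    (Eventually.of_forall hM)

namespace PMMSpace

theorem pushforward_eq (X : PMMSpace.{u}) {Z : Type w} [MeasurableSpace Z] (ι : X.supp → Z) :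
    X.pushforward ι = X.suppMeasure.map ι := rfl

theorem integral_pushforward (X : PMMSpace.{u}) {Z : Type w} [MetricSpace Z] [MeasurableSpace Z]
    [BorelSpace Z] {ι : X.supp → Z} (hι : Isometry ι) {φ : Z → ℝ} (hφ : Continuous φ) :
    ∫ z, φ z ∂X.pushforward ι = ∫ z, φ (ι z) ∂X.suppMeasure := by
  rw [pushforward_eq, integral_map_of_stronglyMeasurable hι.continuous.measurable
    hφ.measurable.stronglyMeasurable]

end PMMSpace

namespace MMSpace

/-- All bounded subsets of the support are totally bounded. -/
def HasTotallyBoundedBalls (X : MMSpace.{u}) : Prop :=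
  ∀ (x : X) (R : ℝ), TotallyBounded (Metric.ball x R ∩ X.supp)

theorem HasTotallyBoundedBalls.rescale {X : MMSpace.{u}} (h : X.HasTotallyBoundedBalls) (x : X)
    (hx : x ∈ X.supp) {r : ℝ} (hr : 0 < r) :
    (X.rescale x hx r hr).toMMSpace.HasTotallyBoundedBalls := by
  intro z R
  refine (h z (r * R)).subset fun a ha => ?_
  obtain ⟨ha, haS⟩ := ha
  have hS : (X.rescale x hx r hr).supp = X.supp := X.supp_normalize x hx r hr
  have ha' : r⁻¹ * @dist X _ a z < R := ha
  exact ⟨(inv_mul_lt_iff₀ hr).1 ha', hS ▸ haS⟩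

theorem HasTotallyBoundedBalls.normalize {X : MMSpace.{u}} (h : X.HasTotallyBoundedBalls) (x : X)
    (hx : x ∈ X.supp) {r : ℝ} (hr : 0 < r) : (X.normalize x hx r hr).HasTotallyBoundedBalls := by
  intro z R
  refine (h z R).subset fun a ha => ?_
  exact ⟨ha.1, X.supp_normalize x hx r hr ▸ ha.2⟩

end MMSpace

/-! ### Points and integrals along a convergent sequence -/

namespace PMMSpace

theorem pushforward_lt_top (X : PMMSpace.{u}) {Z : Type w} [MetricSpace Z] [MeasurableSpace Z]
    [BorelSpace Z] {ι : X.supp → Z} (hι : Isometry ι) (s : Set Z) (hs : Bornology.IsBounded s) :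
    X.pushforward ι s < ⊤ := by
  refine (measure_mono subset_closure).trans_lt ?_
  rw [pushforward_eq, Measure.map_apply hι.continuous.measurable isClosed_closure.measurableSet]
  exact X.suppMeasure_lt_top _ (hι.antilipschitz.isBounded_preimage hs.closure)

/-- Isometric embeddings into `Z` that realize the convergence of `S` to `T`. -/
structure ConvergesVia (S : ℕ → PMMSpace.{u}) (T : PMMSpace.{v}) {Z : Type w} [MetricSpace Z]
    [MeasurableSpace Z] (ι : ∀ i, (S i).supp → Z) (ι' : T.supp → Z) : Prop where
  isometry : ∀ i, Isometry (ι i)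
  isometry' : Isometry ι'
  balls : ∀ ε : ℝ, 0 < ε → ∀ R : ℝ, 0 < R → ∃ i₀ : ℕ, ∀ i, i₀ < i →
      ι' '' Metric.ball T.base R ⊆ Metric.thickening ε (ι i '' Metric.ball (S i).base R) ∧
      ι i '' Metric.ball (S i).base R ⊆ Metric.thickening ε (ι' '' Metric.ball T.base R)
  integrals : ∀ φ : Z → ℝ, Continuous φ → (∃ M : ℝ, ∀ z, |φ z| ≤ M) →
      Bornology.IsBounded (Function.support φ) →
      Tendsto (fun i => ∫ z, φ z ∂((S i).pushforward (ι i))) atTop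
        (𝓝 (∫ z, φ z ∂(T.pushforward ι')))

namespace ConvergesVia

variable {S : ℕ → PMMSpace.{u}} {T : PMMSpace.{v}} {Z : Type w} [MetricSpace Z]
    [MeasurableSpace Z] {ι : ∀ i, (S i).supp → Z} {ι' : T.supp → Z}

theorem eventually_exists_near (h : ConvergesVia S T ι ι') {ε R : ℝ} (hε : 0 < ε) (hR : 0 < R) :
    ∀ᶠ n in atTop,
      (∀ y : T.supp, dist y T.base < R → ∃ x : (S n).supp, dist x (S n).base < R ∧
        dist (ι n x) (ι' y) < ε) ∧
      (∀ x : (S n).supp, dist x (S n).base < R → ∃ y : T.supp, dist y T.base < R ∧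
        dist (ι n x) (ι' y) < ε) := by
  obtain ⟨i₀, hi⟩ := h.balls ε hε R hR
  filter_upwards [eventually_gt_atTop i₀] with n hn
  obtain ⟨h1, h2⟩ := hi n hn
  constructor
  · intro y hy
    obtain ⟨_, ⟨x, hx, rfl⟩, hd⟩ := Metric.mem_thickening_iff.1 (h1 ⟨y, hy, rfl⟩)
    exact ⟨x, hx, by rwa [dist_comm]⟩
  · intro x hx
    obtain ⟨_, ⟨y, hy, rfl⟩, hd⟩ := Metric.mem_thickening_iff.1 (h2 ⟨x, hx, rfl⟩)
    exact ⟨y, hy, hd⟩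

/-- Almost nearest points work, because the distance from the given point to the images tends to 0.
-/
theorem exists_tendsto (h : ConvergesVia S T ι ι') (y : T.supp) :
    ∃ x : ∀ n, (S n).supp, Tendsto (fun n => ι n (x n)) atTop (𝓝 (ι' y)) := by
  have hx : ∀ n, ∃ x : (S n).supp,
      dist (ι' y) (ι n x) < Metric.infDist (ι' y) (range (ι n)) + 1 / ((n : ℝ) + 1) := by
    intro n
    have hne : (range (ι n)).Nonempty := ⟨_, (S n).base, rfl⟩
    obtain ⟨_, ⟨x, rfl⟩, hx⟩ := (Metric.infDist_lt_iff (x := ι' y)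
      (r := Metric.infDist (ι' y) (range (ι n)) + 1 / ((n : ℝ) + 1)) hne).1
      (by linarith [show (0 : ℝ) < 1 / ((n : ℝ) + 1) by positivity])
    exact ⟨x, hx⟩
  choose x hx using hx
  refine ⟨x, Metric.tendsto_atTop'.2 fun ε hε => ?_⟩
  have h1 := h.eventually_exists_near (half_pos hε) (R := dist y T.base + 1) (by positivity)
  have h2 : ∀ᶠ n : ℕ in atTop, 1 / ((n : ℝ) + 1) < ε / 2 :=
    tendsto_one_div_add_atTop_nhds_zero_nat.eventually_lt_const (half_pos hε)
  obtain ⟨n₀, hn₀⟩ := eventually_atTop.1 (h1.and h2)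
  refine ⟨n₀, fun n hn => ?_⟩
  obtain ⟨⟨h1, -⟩, h2⟩ := hn₀ n hn.le
  obtain ⟨x', -, hx'⟩ := h1 y (by linarith)
  have h3 : Metric.infDist (ι' y) (range (ι n)) ≤ dist (ι' y) (ι n x') :=
    Metric.infDist_le_dist_of_mem ⟨x', rfl⟩
  rw [dist_comm (ι' y)] at h3
  have := hx n
  rw [dist_comm]
  linarith

theorem tendsto_base (h : ConvergesVia S T ι ι') :
    Tendsto (fun n => ι n (S n).base) atTop (𝓝 (ι' T.base)) := by
  refine Metric.tendsto_atTop'.2 fun ε hε => ?_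
  obtain ⟨n₀, hn₀⟩ := eventually_atTop.1 (h.eventually_exists_near (half_pos hε) (half_pos hε))
  refine ⟨n₀, fun n hn => ?_⟩
  obtain ⟨x, hx, hd⟩ := (hn₀ n hn.le).1 T.base (by simpa using hε)
  have h1 := dist_triangle (ι n (S n).base) (ι n x) (ι' T.base)
  rw [(h.isometry n).dist_eq, dist_comm (S n).base] at h1
  linarith

variable [BorelSpace Z]

/-- Integrals converge along uniformly convergent functions with supports in a common ball. -/
theorem tendsto_integral (h : ConvergesVia S T ι ι') {F : ℕ → Z → ℝ} {F₀ : Z → ℝ} {e : ℕ → ℝ}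
    {c : Z} {R : ℝ} (hR : 0 < R) (hF : ∀ n, Continuous (F n)) (hF₀ : Continuous F₀)
    (hb : ∀ z, |F₀ z| ≤ 1) (he : Tendsto e atTop (𝓝 0)) (hd : ∀ n z, |F n z - F₀ z| ≤ e n)
    (hs : ∀ᶠ n in atTop, ∀ z, F n z ≠ 0 → dist z c ≤ R) (hs₀ : ∀ z, F₀ z ≠ 0 → dist z c ≤ R) :
    Tendsto (fun n => ∫ z, F n z ∂((S n).pushforward (ι n))) atTop
      (𝓝 (∫ z, F₀ z ∂(T.pushforward ι'))) := by
  have hsF₀ : Bornology.IsBounded (Function.support F₀) :=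
    Metric.isBounded_closedBall.subset fun z hz => hs₀ z hz
  have h0 := h.integrals F₀ hF₀ ⟨1, hb⟩ hsF₀
  -- This cut-off is 1 on the common ball, so `e n` times its integral bounds the difference. Its
  -- integrals converge, hence stay bounded.
  set χ : Z → ℝ := fun z => tent R (dist z c) with hχ
  have hcχ : Continuous χ := (continuous_tent R).comp (by fun_prop)
  have hbχ : ∀ z, |χ z| ≤ 1 := fun z => by
    rw [abs_of_nonneg (tent_nonneg _ _)]; exact tent_le_one _ _
  have hsχ : Bornology.IsBounded (Function.support χ) :=
    (Metric.isBounded_ball (x := c) (r := 2 * R)).subset fun z hz => lt_of_tent_ne_zero hR hz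
  have h1 := h.integrals χ hcχ ⟨1, hbχ⟩ hsχ
  have h2 := he.mul h1
  rw [zero_mul] at h2
  have h3 : Tendsto (fun n => ∫ z, F n z ∂((S n).pushforward (ι n)) -
      ∫ z, F₀ z ∂((S n).pushforward (ι n))) atTop (𝓝 0) := by
    refine squeeze_zero_norm' ?_ h2
    filter_upwards [hs] with n hn
    have hfin := (S n).pushforward_lt_top (h.isometry n)
    have i0 : Integrable F₀ ((S n).pushforward (ι n)) :=
      integrable_of_isBounded_support hfin hF₀ hb hsF₀
    have iχ : Integrable χ ((S n).pushforward (ι n)) :=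
      integrable_of_isBounded_support hfin hcχ hbχ hsχ
    have i1 : Integrable (F n) ((S n).pushforward (ι n)) := by
      refine integrable_of_isBounded_support hfin (hF n) (M := e n + 1) (fun z => ?_)
        (Metric.isBounded_closedBall.subset fun z hz => hn z hz)
      have := abs_add_le (F n z - F₀ z) (F₀ z)
      rw [sub_add_cancel] at this
      linarith [hd n z, hb z]
    rw [← integral_sub i1 i0, ← integral_const_mul]
    refine norm_integral_le_of_norm_le (iχ.const_mul _) (Eventually.of_forall fun z => ?_)
    rw [Real.norm_eq_abs]
    by_cases hz : dist z c ≤ R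
    · rw [hχ]; simp only [tent_eq_one hR hz, mul_one]; exact hd n z
    · have a1 : F n z = 0 := by by_contra h; exact hz (hn z h)
      have a2 : F₀ z = 0 := by by_contra h; exact hz (hs₀ z h)
      rw [a1, a2, sub_zero, abs_zero]
      exact mul_nonneg ((abs_nonneg _).trans (hd n z)) (tent_nonneg _ _)
  simpa using h3.add h0

theorem tendsto_integral_cap (h : ConvergesVia S T ι ι') {P : ℕ → ℕ → Z} {P₀ : ℕ → Z}
    (hP : ∀ j, Tendsto (fun n => P n j) atTop (𝓝 (P₀ j))) {ε s : ℝ} (hε : 0 < ε) (hs : 0 < s)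
    (N : ℕ) :
    Tendsto (fun n => ∫ z, cap ε (fun a b => s⁻¹ * dist a b) (P n) N z ∂((S n).pushforward (ι n)))
      atTop (𝓝 (∫ z, cap ε (fun a b => s⁻¹ * dist a b) P₀ N z ∂(T.pushforward ι'))) := by
  have hcont : ∀ q : ℕ → Z, Continuous (cap ε (fun a b => s⁻¹ * dist a b) q N) := fun q =>
    continuous_cap (fun j => by fun_prop) N
  -- Once the moving centres are within 1 of their limits, all the caps are supported in the ball of
  -- this radius about `P₀ 0`.
  set R : ℝ := s * (2 * ε) + 1 + ∑ j ∈ Finset.range N, dist (P₀ j) (P₀ 0) with hR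
  have hsum : ∀ j < N, dist (P₀ j) (P₀ 0) ≤ ∑ j ∈ Finset.range N, dist (P₀ j) (P₀ 0) := fun j hj =>
    Finset.single_le_sum (f := fun j => dist (P₀ j) (P₀ 0)) (fun _ _ => dist_nonneg)
      (Finset.mem_range.2 hj)
  have hsum0 : 0 ≤ ∑ j ∈ Finset.range N, dist (P₀ j) (P₀ 0) :=
    Finset.sum_nonneg fun _ _ => dist_nonneg
  have hlt : ∀ {a b : Z}, s⁻¹ * dist a b < 2 * ε → dist a b < s * (2 * ε) := fun h =>
    (inv_mul_lt_iff₀ hs).1 h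
  refine h.tendsto_integral (c := P₀ 0) (R := R)
    (e := fun n => ∑ j ∈ Finset.range N, s⁻¹ * dist (P n j) (P₀ j) / ε) (by positivity)
    (fun n => hcont _) (hcont _) (fun z => ?_) ?_ (fun n z => ?_) ?_ (fun z hz => ?_)
  · rw [abs_of_nonneg (cap_nonneg _ _)]; exact cap_le_one _ _
  · rw [← Finset.sum_const_zero (s := Finset.range N) (ι := ℕ)]
    refine tendsto_finsetSum _ fun j _ => ?_
    simpa using (((hP j).dist (tendsto_const_nhds (x := P₀ j))).const_mul s⁻¹).div_const ε
  · refine (abs_cap_sub_cap_le hε z z N).trans (Finset.sum_le_sum fun j _ => ?_)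
    have : |dist z (P n j) - dist z (P₀ j)| ≤ dist (P n j) (P₀ j) := by
      rw [dist_comm z, dist_comm z]; exact abs_dist_sub_le ..
    rw [← mul_sub, abs_mul, abs_of_pos (inv_pos.2 hs)]
    gcongr
  · have : ∀ᶠ n in atTop, ∀ j ∈ Finset.range N, dist (P n j) (P₀ j) < 1 := by
      refine (Finset.eventually_all _).2 fun j _ => ?_
      exact (hP j).eventually (Metric.ball_mem_nhds _ one_pos)
    filter_upwards [this] with n hn z hz
    obtain ⟨j, hj, hlt'⟩ := exists_lt_of_cap_ne_zero hε hz
    have h1 := hlt hlt'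
    have h2 := hn j (Finset.mem_range.2 hj)
    have h3 := hsum j hj
    have h4 := dist_triangle4 z (P n j) (P₀ j) (P₀ 0)
    linarith
  · obtain ⟨j, hj, hlt'⟩ := exists_lt_of_cap_ne_zero hε hz
    have h1 := hlt hlt'
    have h3 := hsum j hj
    have h4 := dist_triangle z (P₀ j) (P₀ 0)
    linarith

theorem tendsto_integral_cone (h : ConvergesVia S T ι ι') {q : ℕ → Z} {q₀ : Z}
    (hq : Tendsto q atTop (𝓝 q₀)) {s : ℝ} (hs : 0 < s) :
    Tendsto (fun n => ∫ z, cone (fun a b => s⁻¹ * dist a b) (q n) z ∂((S n).pushforward (ι n)))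
      atTop (𝓝 (∫ z, cone (fun a b => s⁻¹ * dist a b) q₀ z ∂(T.pushforward ι'))) := by
  have hcont : ∀ q : Z, Continuous (cone (fun a b => s⁻¹ * dist a b) q) := fun q => by
    unfold cone; fun_prop
  have hlt : ∀ {a b : Z}, cone (fun a b => s⁻¹ * dist a b) b a ≠ 0 → dist a b ≤ s := fun h => by
    by_contra! hc
    refine h (max_eq_left ?_)
    have : 1 ≤ s⁻¹ * dist _ _ := (le_inv_mul_iff₀ hs).2 (by rw [mul_one]; exact hc.le)
    linarith
  refine h.tendsto_integral (c := q₀) (R := s + 1)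
    (e := fun n => s⁻¹ * dist (q n) q₀) (by positivity)
    (fun n => hcont _) (hcont _) (fun z => ?_) ?_ (fun n z => ?_) ?_ (fun z hz => ?_)
  · rw [abs_of_nonneg (cone_nonneg _ _ _)]
    have : 0 ≤ s⁻¹ * dist z q₀ := by positivity
    exact max_le zero_le_one (by linarith)
  · simpa using ((hq.dist (tendsto_const_nhds (x := q₀))).const_mul s⁻¹)
  · refine (abs_cone_sub_cone_le _ _ _ _ _ _).trans ?_
    have : |dist z (q n) - dist z q₀| ≤ dist (q n) q₀ := by
      rw [dist_comm z, dist_comm z]; exact abs_dist_sub_le ..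
    rw [← mul_sub, abs_mul, abs_of_pos (inv_pos.2 hs)]
    gcongr
  · filter_upwards [hq.eventually (Metric.ball_mem_nhds _ one_pos)] with n hn z hz
    have h1 := hlt hz
    have h4 := dist_triangle z (q n) q₀
    have : dist (q n) q₀ < 1 := hn
    linarith
  · linarith [hlt hz]

end ConvergesVia

/-- Keeps the denominator of the mass ratios away from 0 in the limit, so that the ratios converge.
-/
theorem integral_cone_pos (T : PMMSpace.{v}) (y : T.supp) {s : ℝ} (hs : 0 < s) :
    0 < ∫ z, cone (fun a b : T.toMMSpace => s⁻¹ * dist a b) y z ∂T.measure := by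
  have hcont : Continuous (cone (fun a b : T.toMMSpace => s⁻¹ * dist a b) y) := by
    unfold cone; fun_prop
  have hsub : Metric.ball (y : T.toMMSpace) s ⊆
      Function.support (cone (fun a b : T.toMMSpace => s⁻¹ * dist a b) y) := fun z hz => by
    have : s⁻¹ * dist z y < 1 := (inv_mul_lt_iff₀ hs).2 (by rw [mul_one]; exact hz)
    have : 0 < cone (fun a b : T.toMMSpace => s⁻¹ * dist a b) y z :=
      lt_max_of_lt_right (by linarith)
    exact this.ne'
  have hbd : Bornology.IsBounded
      (Function.support (cone (fun a b : T.toMMSpace => s⁻¹ * dist a b) y)) := by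
    refine (Metric.isBounded_closedBall (x := (y : T.toMMSpace)) (r := s)).subset fun z hz => ?_
    by_contra hc
    refine hz (max_eq_left ?_)
    have : 1 ≤ s⁻¹ * dist z y :=
      (le_inv_mul_iff₀ hs).2 (by rw [mul_one]; exact (not_le.1 hc).le)
    linarith
  rw [integral_pos_iff_support_of_nonneg (fun z => cone_nonneg _ _ _)
    (integrable_of_isBounded_support T.finite_of_isBounded hcont (M := 1) (fun z => ?_) hbd)]
  · exact ((Measure.mem_support_iff_forall _).1 y.2 _ (Metric.ball_mem_nhds _ hs)).trans_le
      (measure_mono hsub)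
  · rw [abs_of_nonneg (cone_nonneg _ _ _)]
    have : 0 ≤ s⁻¹ * dist z y := by positivity
    exact max_le zero_le_one (by linarith)

/-- Integrals of caps around points of the support can be computed after an isometric embedding. -/
theorem integral_cap_pushforward (X : PMMSpace.{u}) {Z : Type w} [MetricSpace Z]
    [MeasurableSpace Z] [BorelSpace Z] {ι : X.supp → Z} (hι : Isometry ι) (p : ℕ → X.supp)
    (ε s : ℝ) (N : ℕ) :
    ∫ z, cap ε (fun a b => s⁻¹ * dist a b) (fun j => ι (p j)) N z ∂X.pushforward ι =
      ∫ z, cap ε (fun a b => s⁻¹ * dist a b) (fun j => (p j : X.toMMSpace)) N z ∂X.measure := by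
  rw [X.integral_pushforward hι (continuous_cap (fun j => by fun_prop) N),
    ← X.toMMSpace.integral_suppMeasure]
  exact integral_congr_ae (Eventually.of_forall fun z =>
    cap_congr (fun j => by rw [hι.dist_eq, Subtype.dist_eq]) N)

theorem integral_cone_pushforward (X : PMMSpace.{u}) {Z : Type w} [MetricSpace Z]
    [MeasurableSpace Z] [BorelSpace Z] {ι : X.supp → Z} (hι : Isometry ι) (q : X.supp) (s : ℝ) :
    ∫ z, cone (fun a b => s⁻¹ * dist a b) (ι q) z ∂X.pushforward ι =
      ∫ z, cone (fun a b => s⁻¹ * dist a b) (q : X.toMMSpace) z ∂X.measure := by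
  rw [X.integral_pushforward hι (by unfold cone; fun_prop), ← X.toMMSpace.integral_suppMeasure]
  refine integral_congr_ae (Eventually.of_forall fun z => ?_)
  simp only [cone, hι.dist_eq, Subtype.dist_eq]

/-! ### Openness of codes -/

/-- Codes realized by the limit are eventually realized along the sequence, around any points that
converge. -/
theorem ConvergesVia.eventually_sat {S : ℕ → PMMSpace.{u}} {T : PMMSpace.{v}} {Z : Type w}
    [MetricSpace Z] [MeasurableSpace Z] [BorelSpace Z] {ι : ∀ i, (S i).supp → Z} {ι' : T.supp → Z}
    (h : ConvergesVia S T ι ι') {x : ∀ n, (S n).supp} {y : T.supp}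
    (hx : Tendsto (fun n => ι n (x n)) atTop (𝓝 (ι' y))) {s : ℝ} (hs : 0 < s) {N k l : ℕ}
    (hT : T.Sat N k l (y : T.toMMSpace) s) :
    ∀ᶠ n in atTop, (S n).Sat N k l (x n : (S n).toMMSpace) s := by
  obtain ⟨p₀, hp0, hpS, ⟨δ, hδ, hnet⟩, hdata⟩ := hT
  lift p₀ to ℕ → T.supp using hpS
  have hp0' : p₀ 0 = y := Subtype.ext hp0
  have hp : ∀ j, ∃ p : ∀ n, (S n).supp, Tendsto (fun n => ι n (p n)) atTop (𝓝 (ι' (p₀ j))) :=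
    fun j => h.exists_tendsto _
  choose q hq using hp
  -- The initial point has to be exactly `x n`; the other points may be any approximants.
  set p : ∀ n : ℕ, ℕ → (S n).supp := fun n j => if j = 0 then x n else q j n with hpdef
  have hp : ∀ j, Tendsto (fun n => ι n (p n j)) atTop (𝓝 (ι' (p₀ j))) := by
    intro j
    rcases eq_or_ne j 0 with rfl | hj
    · simpa [hpdef, hp0'] using hx
    · simpa [hpdef, hj] using hq j
  have hdist : ∀ i j, Tendsto (fun n => dist (p n i : (S n).toMMSpace) (p n j)) atTop
      (𝓝 (dist (p₀ i : T.toMMSpace) (p₀ j))) := by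
    intro i j
    have := (hp i).dist (hp j)
    rw [h.isometry'.dist_eq] at this
    refine this.congr fun n => ?_
    rw [(h.isometry n).dist_eq, Subtype.dist_eq]
  have hcone : Tendsto (fun n => ∫ z, cone (fun a b : (S n).toMMSpace => s⁻¹ * dist a b) (p n 0) z
      ∂(S n).measure) atTop
      (𝓝 (∫ z, cone (fun a b : T.toMMSpace => s⁻¹ * dist a b) (p₀ 0) z ∂T.measure)) := by
    have := h.tendsto_integral_cone (hp 0) hs
    rw [T.integral_cone_pushforward h.isometry'] at this
    exact this.congr fun n => (S n).integral_cone_pushforward (h.isometry n) _ _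
  have hcap : ∀ j, Tendsto (fun n => ∫ z, cap (mesh k) (fun a b : (S n).toMMSpace => s⁻¹ * dist a b)
      (fun j => p n j) j z ∂(S n).measure) atTop
      (𝓝 (∫ z, cap (mesh k) (fun a b : T.toMMSpace => s⁻¹ * dist a b) (fun j => p₀ j) j z
        ∂T.measure)) := by
    intro j
    have := h.tendsto_integral_cap hp (mesh_pos k) hs j
    rw [T.integral_cap_pushforward h.isometry'] at this
    exact this.congr fun n => (S n).integral_cap_pushforward (h.isometry n) _ _ _ _
  have hlim : Tendsto (fun n => netData N k (fun a b : (S n).toMMSpace => s⁻¹ * dist a b)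
      (S n).measure (fun j => (p n j : (S n).toMMSpace))) atTop
      (𝓝 (netData N k (fun a b : T.toMMSpace => s⁻¹ * dist a b) T.measure
        (fun j => (p₀ j : T.toMMSpace)))) := by
    refine Tendsto.prodMk_nhds ?_ ?_
    · exact tendsto_pi_nhds.2 fun i => tendsto_pi_nhds.2 fun j => (hdist i j).const_mul _
    · exact tendsto_pi_nhds.2 fun j => (hcap (j + 1)).div hcone (T.integral_cone_pos _ hs).ne'
  have e1 := (hlim.dist (tendsto_const_nhds (x := TopologicalSpace.denseSeq (NetDataSpace N) l))
    ).eventually_lt_const hdata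
  have hη : 0 < s * δ / 4 := by positivity
  set R : ℝ := s * (k + 1 + δ) + dist y T.base + 2 with hR
  have e2 := h.eventually_exists_near (ε := s * δ / 4) hη (R := R) (by positivity)
  have e3 : ∀ᶠ n in atTop, ∀ j ∈ Finset.range N, dist (ι n (p n j)) (ι' (p₀ j)) < s * δ / 4 :=
    (Finset.eventually_all _).2 fun j _ => (hp j).eventually (Metric.ball_mem_nhds _ hη)
  have e4 : ∀ᶠ n in atTop, dist (ι n (x n)) (ι' y) < s * δ / 4 :=
    hx.eventually (Metric.ball_mem_nhds _ hη)
  have e5 : ∀ᶠ n in atTop, dist (ι n (x n)) (ι' y) < 1 :=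
    hx.eventually (Metric.ball_mem_nhds _ one_pos)
  have e6 : ∀ᶠ n in atTop, dist (ι n (S n).base) (ι' T.base) < 1 :=
    h.tendsto_base.eventually (Metric.ball_mem_nhds _ one_pos)
  filter_upwards [e1, e2, e3, e4, e5, e6] with n h1 h2 h3 h4 h5 h6
  -- Comparison with the limit costs two errors of s δ / 4, both for the radius of the ball and for
  -- the fineness of the net, so the margin δ leaves δ / 4.
  refine ⟨fun j => p n j, by simp [hpdef], fun j => (p n j).2, ⟨δ / 4, by positivity, ?_⟩, h1⟩
  intro z hz hzb
  lift z to (S n).supp using hz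
  have hzb' : dist z (x n) < s * (k + 1 + δ / 4) := (inv_mul_lt_iff₀ hs).1 hzb
  have hzR : dist z (S n).base < R := by
    have t1 := dist_triangle z (x n) (S n).base
    have t2 := dist_triangle4 (ι n (x n)) (ι' y) (ι' T.base) (ι n (S n).base)
    rw [(h.isometry n).dist_eq, h.isometry'.dist_eq, dist_comm (ι' T.base)] at t2
    rw [hR]; nlinarith
  obtain ⟨w, -, hw⟩ := h2.2 z hzR
  have hwy : dist w y < s * (k + 1 + δ) := by
    have t := dist_triangle4 (ι' w) (ι n z) (ι n (x n)) (ι' y)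
    rw [(h.isometry n).dist_eq, h.isometry'.dist_eq, dist_comm (ι' w)] at t
    nlinarith
  obtain ⟨j, hj, hwj⟩ := hnet w w.2 ((inv_mul_lt_iff₀ hs).2 hwy)
  have hwj' : dist w (p₀ j) < s * (mesh k - δ) := (inv_mul_lt_iff₀ hs).1 hwj
  refine ⟨j, hj, (inv_mul_lt_iff₀ hs).2 ?_⟩
  change dist z (p n j) < _
  have h3' := h3 j (Finset.mem_range.2 hj)
  have t := dist_triangle4 (ι n z) (ι' w) (ι' (p₀ j)) (ι n (p n j))
  rw [(h.isometry n).dist_eq, h.isometry'.dist_eq, dist_comm (ι' (p₀ j))] at t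
  nlinarith

/-! ### Properties inherited by limits and tangents -/

theorem totallyBounded_ball_base_iff (X : PMMSpace.{u}) :
    (∀ R : ℝ, TotallyBounded (Metric.ball X.base R)) ↔ X.HasTotallyBoundedBalls := by
  constructor
  · intro h x R
    refine ((h (R + dist x X.pt)).image (uniformContinuous_subtype_val (p := (· ∈ X.supp)))).subset ?_
    rintro z ⟨hz, hzS⟩
    refine ⟨⟨z, hzS⟩, ?_, rfl⟩
    have hz : dist z x < R := hz
    change dist z X.pt < _
    linarith [dist_triangle z x X.pt]
  · intro h R
    have := totallyBounded_preimage
      (isUniformEmbedding_subtype_val (p := (· ∈ X.supp))).isUniformInducing (h X.pt R)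
    exact this.subset fun z hz => (⟨hz, z.2⟩ : z.1 ∈ Metric.ball X.pt R ∩ X.supp)

/-- In the common space, each ball of the limit lies in an arbitrarily small neighbourhood of a
totally bounded ball of some member of the sequence. -/
theorem ConvergesVia.hasTotallyBoundedBalls {S : ℕ → PMMSpace.{u}} {T : PMMSpace.{v}} {Z : Type w}
    [MetricSpace Z] [MeasurableSpace Z] [BorelSpace Z] {ι : ∀ i, (S i).supp → Z} {ι' : T.supp → Z}
    (h : ConvergesVia S T ι ι') (hS : ∀ n, (S n).HasTotallyBoundedBalls) :
    T.HasTotallyBoundedBalls := by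
  refine T.totallyBounded_ball_base_iff.1 fun R => ?_
  rcases le_or_gt R 0 with hR | hR
  · rw [Metric.ball_eq_empty.2 hR]; exact totallyBounded_empty
  have : TotallyBounded (ι' '' Metric.ball T.base R) := by
    refine Metric.totallyBounded_iff.2 fun ε hε => ?_
    obtain ⟨n, hn⟩ := (h.eventually_exists_near (half_pos hε) hR).exists
    obtain ⟨t, ht, hcov⟩ := Metric.totallyBounded_iff.1
      (((S n).totallyBounded_ball_base_iff.2 (hS n) R).image (h.isometry n).uniformContinuous) (ε / 2) (half_pos hε)
    refine ⟨t, ht, ?_⟩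
    rintro _ ⟨y, hy, rfl⟩
    obtain ⟨x, hx, hd⟩ := hn.1 y hy
    obtain ⟨c, hc, hxc⟩ := mem_iUnion₂.1 (hcov ⟨x, hx, rfl⟩)
    refine mem_iUnion₂.2 ⟨c, hc, ?_⟩
    have t := dist_triangle (ι' y) (ι n x) c
    rw [dist_comm (ι' y) (ι n x)] at t
    have hxc : dist (ι n x) c < ε / 2 := hxc
    change dist (ι' y) c < ε
    linarith
  have h2 := totallyBounded_preimage h.isometry'.isUniformInducing this
  rwa [preimage_image_eq _ h.isometry'.injective] at h2

theorem exists_convergesVia {S : ℕ → PMMSpace.{u}} {T : PMMSpace.{v}} (h : Converges S T) :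
    ∃ (Z : Type) (_ : MetricSpace Z) (_ : MeasurableSpace Z) (_ : BorelSpace Z)
      (ι : ∀ i, (S i).supp → Z) (ι' : T.supp → Z), ConvergesVia S T ι ι' := by
  obtain ⟨Z, i1, _, i3, i4, ι, ι', h1, h2, h3, h4⟩ := h
  exact ⟨Z, i1, i3, i4, ι, ι', ⟨h1, h2, h3, h4⟩⟩

end PMMSpace

namespace MMSpace

theorem integral_cone_eq_normConst (X : MMSpace.{u}) (x : X) {r : ℝ} (hr : 0 < r) :
    ∫ z, cone (fun a b : X => r⁻¹ * dist a b) x z ∂X.measure = (X.normConst x r).toReal := by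
  have hcont : Continuous (cone (fun a b : X => r⁻¹ * dist a b) x) := by
    unfold cone; fun_prop
  rw [integral_eq_lintegral_of_nonneg_ae (Eventually.of_forall fun z => cone_nonneg _ _ _)
    hcont.measurable.aestronglyMeasurable, normConst,
    ← lintegral_indicator Metric.isOpen_ball.measurableSet]
  congr 1
  refine lintegral_congr fun z => ?_
  by_cases hz : z ∈ Metric.ball x r
  · rw [indicator_of_mem hz, cone, ENNReal.ofReal_max, ENNReal.ofReal_zero,
      max_eq_right zero_le, inv_mul_eq_div]
  · rw [indicator_of_notMem hz, cone, max_eq_left, ENNReal.ofReal_zero]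
    have : 1 ≤ r⁻¹ * dist z x :=
      (le_inv_mul_iff₀ hr).2 (by rw [mul_one]; exact not_lt.1 hz)
    linarith

theorem integral_cone_rescale (X : MMSpace.{u}) (x : X) (hx : x ∈ X.supp) {r : ℝ} (hr : 0 < r) :
    ∫ z, cone (fun a b => (1 : ℝ)⁻¹ * dist a b) (X.rescale x hx r hr).pt z
      ∂(X.rescale x hx r hr).measure = 1 := by
  have h1 : ∫ z, cone (fun a b => (1 : ℝ)⁻¹ * dist a b) (X.rescale x hx r hr).pt z
      ∂(X.rescale x hx r hr).measure =
      ∫ z, cone (fun a b : X => r⁻¹ * dist a b) x z ∂((X.normConst x r)⁻¹ • X.measure) := by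
    refine integral_congr_ae (Eventually.of_forall fun z => ?_)
    simp only [cone, inv_one, one_mul]
    rfl
  rw [h1, integral_smul_measure, X.integral_cone_eq_normConst x hr, ENNReal.toReal_inv, smul_eq_mul]
  exact inv_mul_cancel₀ (ENNReal.toReal_pos (X.normConst_ne_zero hx hr)
    (X.normConst_ne_top x hr)).ne'

/-- The normalization passes to tangents. -/
theorem IsTangent.integral_cone_eq_one {X : MMSpace.{u}} {x : X} {Y : PMMSpace.{v}}
    (h : X.IsTangent x Y) : ∫ z, cone (fun a b => (1 : ℝ)⁻¹ * dist a b) Y.pt z ∂Y.measure = 1 := by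
  obtain ⟨hx, r, hr, -, -, hconv⟩ := h
  obtain ⟨Z, _, _, _, ι, ι', h⟩ := PMMSpace.exists_convergesVia hconv
  have h1 := h.tendsto_integral_cone h.tendsto_base one_pos
  rw [Y.integral_cone_pushforward h.isometry'] at h1
  refine tendsto_nhds_unique h1 (tendsto_const_nhds.congr fun n => ?_)
  rw [PMMSpace.integral_cone_pushforward _ (h.isometry n)]
  exact (X.integral_cone_rescale x hx (hr n).1).symm

theorem IsTangent.hasTotallyBoundedBalls {X : MMSpace.{u}} {x : X} {Y : PMMSpace.{v}}
    (h : X.IsTangent x Y) (hX : X.HasTotallyBoundedBalls) : Y.HasTotallyBoundedBalls := by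
  obtain ⟨hx, r, hr, -, -, hconv⟩ := h
  obtain ⟨Z, _, _, _, ι, ι', h⟩ := PMMSpace.exists_convergesVia hconv
  exact h.hasTotallyBoundedBalls fun n => hX.rescale x hx (hr n).1

/-! ### Consequences of doubling -/

namespace IsBoundedlyDoubling

variable {X : MMSpace.{u}} {C : ℝ → ℝ}

theorem measure_ball_pos (h : X.IsBoundedlyDoubling C) (x : X) {r : ℝ} (hr : 0 < r) :
    0 < X.measure (Metric.ball x r) := by
  have := (h x (r / 2) (r / 2) (half_pos hr) le_rfl).1
  rwa [mul_div_cancel₀ r two_ne_zero] at this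

theorem mem_supp (h : X.IsBoundedlyDoubling C) (x : X) : x ∈ X.supp := by
  refine (Measure.mem_support_iff_forall x).2 fun U hU => ?_
  obtain ⟨r, hr, hsub⟩ := Metric.mem_nhds_iff.1 hU
  exact (h.measure_ball_pos x hr).trans_le (measure_mono hsub)

theorem measure_ball_two_pow_le (h : X.IsBoundedlyDoubling C) (x : X) {ρ R : ℝ} (hρ : 0 < ρ)
    (n : ℕ) (hR : 2 ^ n * ρ ≤ R) :
    X.measure (Metric.ball x (2 ^ n * ρ)) ≤
      ENNReal.ofReal (C R) ^ n * X.measure (Metric.ball x ρ) := by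
  induction n with
  | zero => simp
  | succ n ih =>
    have h0 : 0 < 2 ^ n * ρ := by positivity
    have h1 : 2 ^ n * ρ ≤ R := by rw [pow_succ] at hR; linarith
    have h2 := (h x (2 ^ n * ρ) R h0 h1).2
    rw [show (2 : ℝ) * (2 ^ n * ρ) = 2 ^ (n + 1) * ρ by ring] at h2
    refine h2.trans ?_
    rw [pow_succ', mul_assoc]
    gcongr
    exact ih h1

theorem isUnifLocDoublingMeasure (h : X.IsBoundedlyDoubling C) :
    IsUnifLocDoublingMeasure X.measure := by
  -- The square pays for passing between closed and open balls: the closed ball of radius 2 ε is put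
  -- in the open one of radius 4 ε.
  refine ⟨⟨(C 1).toNNReal ^ 2, ?_⟩⟩
  have : Ioo (0 : ℝ) (1 / 4) ∈ 𝓝[>] (0 : ℝ) := Ioo_mem_nhdsGT (by norm_num)
  filter_upwards [this] with ε hε x
  have h1 := h.measure_ball_two_pow_le x hε.1 2 (R := 1) (by linarith [hε.2])
  calc X.measure (Metric.closedBall x (2 * ε)) ≤ X.measure (Metric.ball x (2 ^ 2 * ε)) :=
        measure_mono (Metric.closedBall_subset_ball (by linarith [hε.1]))
    _ ≤ _ := h1
    _ ≤ _ := by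
      push_cast
      exact mul_le_mul_right (measure_mono Metric.ball_subset_closedBall) _

/-- A packing argument: otherwise the ball contains infinitely many ε-separated points, and the
disjoint ε / 2-balls around them have mass bounded below by doubling, within a set of finite mass.
-/
theorem hasTotallyBoundedBalls (h : X.IsBoundedlyDoubling C) : X.HasTotallyBoundedBalls := by
  intro x R
  refine TotallyBounded.subset inter_subset_left ?_
  rcases le_or_gt R 0 with hR | hR
  · rw [Metric.ball_eq_empty.2 hR]; exact totallyBounded_empty
  refine Metric.totallyBounded_iff.2 fun ε hε => ?_
  by_contra! hcon
  have hstep : ∀ t : Finset X, (∀ y ∈ t, y ∈ Metric.ball x R) →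
      ∃ z, z ∈ Metric.ball x R ∧ ∀ y ∈ t, ε ≤ dist y z := by
    intro t _
    obtain ⟨z, hz, hzt⟩ := not_subset.1 (hcon t t.finite_toSet)
    refine ⟨z, hz, fun y hy => ?_⟩
    by_contra! hc
    exact hzt (mem_iUnion₂.2 ⟨y, hy, by rwa [Metric.mem_ball, dist_comm]⟩)
  have : Std.Symm fun y z : X => ε ≤ dist y z := ⟨fun y z hyz => by rwa [dist_comm]⟩
  obtain ⟨f, hf, hsep⟩ := exists_seq_of_forall_finset_exists' _ (fun y z : X => ε ≤ dist y z) hstep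
  obtain ⟨n, hn⟩ := pow_unbounded_of_one_lt (2 * R / (ε / 2)) (one_lt_two (α := ℝ))
  have hn' : 2 * R < 2 ^ n * (ε / 2) := (div_lt_iff₀ (half_pos hε)).1 hn
  have hle : ∀ i, X.measure (Metric.ball x R) ≤
      ENNReal.ofReal (C (2 ^ n * (ε / 2))) ^ n * X.measure (Metric.ball (f i) (ε / 2)) := by
    intro i
    refine (measure_mono ?_).trans (h.measure_ball_two_pow_le (f i) (half_pos hε) n le_rfl)
    refine Metric.ball_subset_ball' ?_
    have : dist (f i) x < R := hf i
    rw [dist_comm]; linarith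
  set c := ENNReal.ofReal (C (2 ^ n * (ε / 2))) ^ n with hc
  have hct : c ≠ ⊤ := ENNReal.pow_ne_top ENNReal.ofReal_ne_top
  have hpos : 0 < X.measure (Metric.ball x R) / c := ENNReal.div_pos (h.measure_ball_pos x hR).ne' hct
  have hdisj : Pairwise (Function.onFun Disjoint fun i => Metric.ball (f i) (ε / 2)) :=
    fun i j hij => Metric.ball_disjoint_ball (by linarith [hsep hij])
  have hfin := Measure.finite_const_le_meas_of_disjoint_iUnion X.measure hpos
    (fun i => Metric.isOpen_ball.measurableSet) hdisj (ne_top_of_le_ne_top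
      (X.finite_of_isBounded _ (Metric.isBounded_ball (x := x) (r := R + ε / 2))).ne
      (measure_mono (iUnion_subset fun i => Metric.ball_subset_ball'
        (by linarith [show dist (f i) x < R from hf i]))))
  refine infinite_univ (hfin.subset fun i _ => ?_)
  exact ENNReal.div_le_of_le_mul' (hle i)

/-- The normalized masses of balls are bounded along the rescalings. -/
theorem exists_measure_ball_le (h : X.IsBoundedlyDoubling C) (R : ℝ) :
    ∃ L : ENNReal, L ≠ ⊤ ∧ ∀ (x : X) (r : ℝ), 0 < r → r < 1 →
      (X.normConst x r)⁻¹ * X.measure (Metric.ball x (r * R)) ≤ L := by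
  obtain ⟨n, hn⟩ := pow_unbounded_of_one_lt (2 * R) (one_lt_two (α := ℝ))
  refine ⟨ENNReal.ofReal (C (2 ^ n)) ^ n * 2,
    ENNReal.mul_ne_top (ENNReal.pow_ne_top ENNReal.ofReal_ne_top) (by simp), fun x r hr hr1 => ?_⟩
  have hle : ENNReal.ofReal (1 / 2) * X.measure (Metric.ball x (r / 2)) ≤ X.normConst x r := by
    calc ENNReal.ofReal (1 / 2) * X.measure (Metric.ball x (r / 2))
        = ∫⁻ _ in Metric.ball x (r / 2), ENNReal.ofReal (1 / 2) ∂X.measure := by simp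
      _ ≤ ∫⁻ z in Metric.ball x (r / 2), ENNReal.ofReal (1 - dist z x / r) ∂X.measure := by
          refine setLIntegral_mono' Metric.isOpen_ball.measurableSet fun z hz => ?_
          refine ENNReal.ofReal_le_ofReal ?_
          have hz' : dist z x < r / 2 := hz
          have : dist z x / r ≤ 1 / 2 := by
            rw [div_le_iff₀ hr]; linarith
          linarith
      _ ≤ X.normConst x r :=
          lintegral_mono_set (Metric.ball_subset_ball (by linarith))
  have hle' : X.measure (Metric.ball x (r / 2)) ≤ 2 * X.normConst x r := by
    have h2 : (2 : ENNReal) * ENNReal.ofReal (1 / 2) = 1 := by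
      rw [← ENNReal.ofReal_ofNat, ← ENNReal.ofReal_mul (by norm_num)]; norm_num
    calc X.measure (Metric.ball x (r / 2))
        = 2 * (ENNReal.ofReal (1 / 2) * X.measure (Metric.ball x (r / 2))) := by
          rw [← mul_assoc, h2, one_mul]
      _ ≤ _ := by gcongr
  have h1 := h.measure_ball_two_pow_le x (half_pos hr) n (R := 2 ^ n)
    (mul_le_of_le_one_right (by positivity) (by linarith))
  have h0 : X.normConst x r ≠ 0 := X.normConst_ne_zero (h.mem_supp x) hr
  calc (X.normConst x r)⁻¹ * X.measure (Metric.ball x (r * R))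
      ≤ (X.normConst x r)⁻¹ * X.measure (Metric.ball x (2 ^ n * (r / 2))) := by
        refine mul_le_mul_right (measure_mono (Metric.ball_subset_ball ?_)) _
        nlinarith
    _ ≤ (X.normConst x r)⁻¹ * (ENNReal.ofReal (C (2 ^ n)) ^ n * (2 * X.normConst x r)) := by
        gcongr; exact h1.trans (by gcongr)
    _ = (ENNReal.ofReal (C (2 ^ n)) ^ n * 2) * ((X.normConst x r)⁻¹ * X.normConst x r) := by ring
    _ = _ := by rw [ENNReal.inv_mul_cancel h0 (X.normConst_ne_top x hr), mul_one]

end IsBoundedlyDoubling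

/-! ### Almost every point is good -/

/-- The points with a tangent that realizes a code around some point and at some scale, although
this code is not realized around the point itself at small scales. -/
def badSet (X : MMSpace.{u}) (N k l m : ℕ) : Set X :=
  {x | (∀ r : ℝ, 0 < r → r < 1 / ((m : ℝ) + 1) → ¬ X.Sat N k l x r) ∧
    ∃ Y : PMMSpace.{v}, X.IsTangent x Y ∧ ∃ y : Y.supp, ∃ ρ > 0, Y.Sat N k l (y : Y.toMMSpace) ρ}

/-- At a density point x of the bad set A, points of X approximating y under the blow-up can be
replaced by points of A at distance o(r n). Openness then realizes the code around points of A at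
small scales, against the definition of A. The density theorem holds for arbitrary sets, so
measurability of A is not an issue. -/
theorem measure_badSet {X : MMSpace.{u}} {C : ℝ → ℝ} (h : X.IsBoundedlyDoubling C)
    (N k l m : ℕ) : ∀ᵐ x ∂X.measure, x ∉ badSet.{u, v} X N k l m := by
  have := UniformSpace.secondCountable_of_separable X.carrier
  have := h.isUnifLocDoublingMeasure
  have : IsLocallyFiniteMeasure X.measure :=
    ⟨fun x => ⟨_, Metric.ball_mem_nhds x one_pos, X.finite_of_isBounded _ Metric.isBounded_ball⟩⟩
  set A := badSet.{u, v} X N k l m with hA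
  have hdens := fun K : ℕ => ae_imp_of_ae_restrict
    (IsUnifLocDoublingMeasure.ae_tendsto_measure_inter_div.{u, 0} X.measure A (K : ℝ))
  filter_upwards [ae_all_iff.2 hdens] with x hxd hxA
  obtain ⟨-, Y, ⟨hx, r, hr, -, hr0, hconv⟩, y, ρ, hρ, hsat⟩ := id hxA
  obtain ⟨Z, _, _, _, ι, ι', hv⟩ := PMMSpace.exists_convergesVia hconv
  obtain ⟨z, hz⟩ := hv.exists_tendsto y
  set z' : ℕ → X := fun n => (z n).1 with hz'
  have hdist : Tendsto (fun n => (r n)⁻¹ * dist x (z' n)) atTop (𝓝 (dist Y.base y)) := by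
    have := hv.tendsto_base.dist hz
    rw [hv.isometry'.dist_eq] at this
    refine this.congr fun n => ?_
    rw [(hv.isometry n).dist_eq]
    rfl
  have hclose : ∀ τ > 0, ∀ᶠ n in atTop, ∃ a ∈ A, dist (z' n) a ≤ τ * r n := by
    intro τ hτ
    -- The balls of radius `τ * r n` around `z' n` need not contain x. The density theorem allows
    -- such eccentric balls as long as their K-fold enlargements do.
    obtain ⟨K, hK⟩ := exists_nat_ge ((dist Y.base y + 1) / τ)
    have hK' : dist Y.base y + 1 ≤ K * τ := (div_le_iff₀ hτ).1 hK
    have hlim := hxd K hxA z' (fun n => τ * r n) (l := atTop) ?_ ?_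
    · filter_upwards [hlim.eventually_ne one_ne_zero] with n hn
      have : (A ∩ Metric.closedBall (z' n) (τ * r n)).Nonempty := by
        by_contra hc
        rw [not_nonempty_iff_eq_empty.1 hc] at hn
        simp at hn
      obtain ⟨a, haA, ha⟩ := this
      exact ⟨a, haA, by rwa [dist_comm]⟩
    · refine tendsto_nhdsWithin_iff.2 ⟨by simpa using hr0.const_mul τ, ?_⟩
      exact Eventually.of_forall fun n => mul_pos hτ (hr n).1
    · filter_upwards [hdist.eventually_lt_const (lt_add_one _)] with n hn
      rw [inv_mul_lt_iff₀ (hr n).1] at hn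
      refine hn.le.trans ?_
      nlinarith [(hr n).1]
  have hne : A.Nonempty := ⟨x, hxA⟩
  -- Almost nearest points of A give a single sequence that serves every τ.
  have ha : ∀ n, ∃ a ∈ A, dist (z' n) a < Metric.infDist (z' n) A + r n / (n + 1) := fun n =>
    (Metric.infDist_lt_iff hne).1 (by
      have := (hr n).1
      linarith [show 0 < r n / ((n : ℝ) + 1) by positivity])
  choose a haA ha using ha
  have hS : ∀ n, (X.rescale x hx (r n) (hr n).1).supp = X.supp := fun n =>
    X.supp_normalize x hx (r n) (hr n).1
  set a' : ∀ n, (X.rescale x hx (r n) (hr n).1).supp := fun n =>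
    ⟨a n, (hS n).symm ▸ h.mem_supp (a n)⟩ with ha'
  have hlim : Tendsto (fun n => ι n (a' n)) atTop (𝓝 (ι' y)) := by
    refine hz.congr_dist ?_
    refine Metric.tendsto_atTop'.2 fun τ hτ => ?_
    have e1 := hclose (τ / 2) (half_pos hτ)
    have e2 : ∀ᶠ n : ℕ in atTop, 1 / ((n : ℝ) + 1) < τ / 2 :=
      tendsto_one_div_add_atTop_nhds_zero_nat.eventually_lt_const (half_pos hτ)
    obtain ⟨n₀, hn₀⟩ := eventually_atTop.1 (e1.and e2)
    refine ⟨n₀, fun n hn => ?_⟩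
    obtain ⟨⟨b, hbA, hb⟩, h2⟩ := hn₀ n hn.le
    have h3 := Metric.infDist_le_dist_of_mem (x := z' n) hbA
    have h4 := ha n
    have hrn := (hr n).1
    rw [(hv.isometry n).dist_eq, Real.dist_0_eq_abs, abs_of_nonneg dist_nonneg]
    change (r n)⁻¹ * dist (z' n) (a n) < τ
    rw [inv_mul_lt_iff₀ hrn]
    have h5 : r n / ((n : ℝ) + 1) = r n * (1 / ((n : ℝ) + 1)) := by ring
    nlinarith
  have e1 := hv.eventually_sat hlim hρ hsat
  have e2 : ∀ᶠ n in atTop, r n * ρ < 1 / ((m : ℝ) + 1) := by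
    have := hr0.mul_const ρ
    rw [zero_mul] at this
    exact this.eventually_lt_const (by positivity)
  obtain ⟨n, h1, h2⟩ := (e1.and e2).exists
  exact (haA n).1 (r n * ρ) (mul_pos (hr n).1 hρ) h2 ((X.sat_rescale_iff x hx (hr n).1 _ _).1 h1)

/-- At almost every point, codes realized by tangents of tangents are realized at small scales. -/
theorem ae_exists_sat {X : MMSpace.{u}} {C : ℝ → ℝ} (h : X.IsBoundedlyDoubling C) :
    ∀ᵐ x ∂X.measure, ∀ Y : PMMSpace.{v}, X.IsTangent x Y →
      ∀ (y' : Y.toMMSpace) (hy' : y' ∈ Y.supp) (W : PMMSpace.{w}),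
        (Y.normalize y' hy' 1 one_pos).IsTangent y' W → ∀ (N k l : ℕ) (s : ℝ), 0 < s →
          W.Sat N k l W.pt s → ∀ η > 0, ∃ r, 0 < r ∧ r < η ∧ X.Sat N k l x r := by
  have := fun N k l m => measure_badSet.{u, v} h N k l m
  filter_upwards [ae_all_iff.2 fun N => ae_all_iff.2 fun k => ae_all_iff.2 fun l =>
    ae_all_iff.2 fun m => this N k l m] with x hx Y hY y' hy' W hW N k l s hs hsat η hη
  obtain ⟨hy₁, ρ, hρ, -, -, hconv⟩ := hW
  obtain ⟨Z, _, _, _, ι, ι', hv⟩ := PMMSpace.exists_convergesVia hconv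
  -- Openness again, now around the base points of the rescalings of Y.
  obtain ⟨n, hn⟩ := (hv.eventually_sat hv.tendsto_base hs hsat).exists
  have hn' := (Y.sat_normalize_iff y' hy' one_pos _ _).1
    (((Y.normalize y' hy' 1 one_pos).sat_rescale_iff y' hy₁ (hρ n).1 _ _).1 hn)
  obtain ⟨m, hm⟩ := exists_nat_one_div_lt hη
  by_contra! hcon
  exact hx N k l m ⟨fun r hr hrm => hcon r hr (hrm.trans hm), Y, hY, ⟨y', hy'⟩, ρ n * s,
    mul_pos (hρ n).1 hs, hn'⟩

end MMSpace

/-! ### Gluing along a common hub -/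

/-- The distance obtained by joining spaces, with distances `L`, through a common hub `H`, where
`D a y` is the distance from a point `a` to a point `y` of the hub. -/
def hubDist {T I H : Type*} [DecidableEq I] (idx : T → I) (L : T → T → ℝ) (D : T → H → ℝ)
    (a b : T) : ℝ :=
  if idx a = idx b then L a b else ⨅ y, D a y + D b y

/-- Joining spaces through a common hub gives a pseudometric. -/
abbrev hubPseudoMetric {T I H : Type*} [DecidableEq I] [MetricSpace H] [Nonempty H] (idx : T → I)
    (L : T → T → ℝ) (D : T → H → ℝ) (hself : ∀ a, L a a = 0) (hcomm : ∀ a b, L a b = L b a)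
    (htri : ∀ a b c, idx a = idx b → idx b = idx c → L a c ≤ L a b + L b c)
    (hLD : ∀ a b y, idx a = idx b → D a y ≤ L a b + D b y)
    (hDH : ∀ a y y', D a y ≤ D a y' + dist y y')
    (hDD : ∀ a b y, idx a = idx b → L a b ≤ D a y + D b y)
    (hHD : ∀ a y y', dist y y' ≤ D a y + D a y') : PseudoMetricSpace T :=
  have hD0 : ∀ a y, 0 ≤ D a y := fun a y => by
    have := hHD a y y
    rw [dist_self] at this
    linarith
  have hbdd : ∀ a b, BddBelow (range fun y => D a y + D b y) := fun a b =>
    ⟨0, by rintro _ ⟨y, rfl⟩; exact add_nonneg (hD0 a y) (hD0 b y)⟩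
  { dist := hubDist idx L D
    dist_self := fun a => by
      rw [hubDist, if_pos rfl, hself]
    dist_comm := fun a b => by
      simp only [hubDist, eq_comm (a := idx a), hcomm a b, add_comm (D a _)]
    dist_triangle := fun a b c => by
      unfold hubDist
      by_cases hab : idx a = idx b <;> by_cases hbc : idx b = idx c
      · rw [if_pos (hab.trans hbc), if_pos hab, if_pos hbc]
        exact htri a b c hab hbc
      · rw [if_neg (fun h => hbc (hab.symm.trans h)), if_pos hab, if_neg hbc, ← sub_le_iff_le_add']
        refine le_ciInf fun y => ?_
        have h1 := ciInf_le (hbdd a c) y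
        have h2 := hLD a b y hab
        linarith
      · rw [if_neg (fun h => hab (h.trans hbc.symm)), if_neg hab, if_pos hbc, ← sub_le_iff_le_add]
        refine le_ciInf fun y => ?_
        have h1 := ciInf_le (hbdd a c) y
        have h2 := hLD c b y hbc.symm
        rw [hcomm c b] at h2
        linarith
      · rw [if_neg hab, if_neg hbc]
        -- The path enters b from the hub at y and leaves to y'. Its two middle legs cost at least
        -- `dist y y'`, so it may be shortened to a path through y alone.
        refine le_ciInf_add_ciInf fun y y' => ?_
        have h1 := hHD b y y'
        have h2 := hDH c y y'
        by_cases hac : idx a = idx c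
        · rw [if_pos hac]
          have h3 := hDD a c y hac
          linarith
        · rw [if_neg hac]
          have h3 := ciInf_le (hbdd a c) y
          linarith }

section hub

variable {E : ℕ → Type u} [∀ n, MetricSpace (E n)] {H : Type v} [MetricSpace H]

/-- The index of a piece of the disjoint union. -/
def hubIdx : H ⊕ (Σ n, E n) → Option ℕ
  | .inl _ => none
  | .inr x => some x.1

/-- The distance within a piece of the disjoint union. -/
def pieceDist : H ⊕ (Σ n, E n) → H ⊕ (Σ n, E n) → ℝ
  | .inl y, .inl y' => dist y y'
  | .inr x, .inr x' => if h : x.1 = x'.1 then dist (h ▸ x.2) x'.2 else 0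
  | _, _ => 0

/-- The distance to the points of the hub. -/
def distToHub (G : ∀ n, E n → H → ℝ) : H ⊕ (Σ n, E n) → H → ℝ
  | .inl y, y' => dist y y'
  | .inr x, y' => G x.1 x.2 y'

/-- Metrics on `E n ⊕ H` extending those of `E n` and `H` have a common extension. -/
theorem exists_pseudoMetric_sum_sigma [Nonempty H] (G : ∀ n, E n → H → ℝ)
    (hLD : ∀ n (a b : E n) y, G n a y ≤ dist a b + G n b y)
    (hDH : ∀ n (a : E n) y y', G n a y ≤ G n a y' + dist y y')
    (hDD : ∀ n (a b : E n) y, dist a b ≤ G n a y + G n b y)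
    (hHD : ∀ n (a : E n) y y', dist y y' ≤ G n a y + G n a y') :
    ∃ (T : Type (max u v)) (_ : PseudoMetricSpace T) (f : ∀ n, E n → T) (g : H → T),
      (∀ n, Isometry (f n)) ∧ Isometry g ∧ (∀ n a y, dist (f n a) (g y) ≤ G n a y) ∧
      range g ∪ ⋃ n, range (f n) = univ := by
  have hG0 : ∀ n (a : E n) y, 0 ≤ G n a y := fun n a y => by
    have := hHD n a y y
    rw [dist_self] at this
    linarith
  let M : PseudoMetricSpace (H ⊕ (Σ n, E n)) := hubPseudoMetric hubIdx pieceDist (distToHub G)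
    (by rintro (y | ⟨n, a⟩) <;> simp [pieceDist])
    (by
      rintro (y | ⟨n, a⟩) (y' | ⟨m, b⟩)
      · exact dist_comm _ _
      · rfl
      · rfl
      · rcases eq_or_ne n m with rfl | h
        · simp [pieceDist, dist_comm]
        · simp [pieceDist, h, h.symm])
    (by
      rintro (y | ⟨n, a⟩) (y' | ⟨m, b⟩) (y'' | ⟨l, c⟩) h h'
      · exact dist_triangle _ _ _
      all_goals first | (simp [hubIdx] at h; done) | (simp [hubIdx] at h'; done) | skip
      obtain rfl : n = m := by simpa [hubIdx] using h
      obtain rfl : n = l := by simpa [hubIdx] using h'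
      simpa [pieceDist] using dist_triangle a b c)
    (by
      rintro (y | ⟨n, a⟩) (y' | ⟨m, b⟩) y'' h
      · exact dist_triangle _ _ _
      all_goals first | (simp [hubIdx] at h; done) | skip
      obtain rfl : n = m := by simpa [hubIdx] using h
      simpa [pieceDist, distToHub] using hLD n a b y'')
    (by
      rintro (y | ⟨n, a⟩) y' y''
      · simpa [distToHub, dist_comm y''] using dist_triangle y y'' y'
      · exact hDH n a y' y'')
    (by
      rintro (y | ⟨n, a⟩) (y' | ⟨m, b⟩) y'' h
      · simpa [pieceDist, distToHub, dist_comm y''] using dist_triangle y y'' y'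
      all_goals first | (simp [hubIdx] at h; done) | skip
      obtain rfl : n = m := by simpa [hubIdx] using h
      simpa [pieceDist, distToHub] using hDD n a b y'')
    (by
      rintro (y | ⟨n, a⟩) y' y''
      · simpa [distToHub, dist_comm y] using dist_triangle y' y y''
      · exact hHD n a y' y'')
  refine ⟨H ⊕ (Σ n, E n), M, fun n a => .inr ⟨n, a⟩, Sum.inl, fun n => ?_, ?_, fun n a y => ?_, ?_⟩
  · refine Isometry.of_dist_eq fun a b => ?_
    change hubDist _ _ _ _ _ = _
    simp [hubDist, pieceDist, hubIdx]
  · refine Isometry.of_dist_eq fun a b => ?_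
    change hubDist _ _ _ _ _ = _
    simp [hubDist, pieceDist, hubIdx]
  · change hubDist _ _ _ _ _ ≤ _
    rw [hubDist, if_neg (by simp [hubIdx])]
    refine (ciInf_le ⟨0, ?_⟩ y).trans ?_
    · rintro _ ⟨y', rfl⟩
      exact add_nonneg (hG0 n a y') dist_nonneg
    · simp [distToHub]
  · refine eq_univ_of_forall ?_
    rintro (y | ⟨n, a⟩)
    · exact Or.inl ⟨y, rfl⟩
    · exact Or.inr (mem_iUnion.2 ⟨n, a, rfl⟩)

/-- A separable pseudometric space maps isometrically to a separable metric space in `Type`. -/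
theorem exists_isometry_separable (T : Type w) [PseudoMetricSpace T]
    [TopologicalSpace.SeparableSpace T] :
    ∃ (Z : Type) (_ : MetricSpace Z) (_ : TopologicalSpace.SeparableSpace Z) (f : T → Z),
      Isometry f := by
  have hsep : TopologicalSpace.SeparableSpace (SeparationQuotient T) :=
    SeparationQuotient.surjective_mk.denseRange.separableSpace SeparationQuotient.continuous_mk
  have hmk : Isometry (SeparationQuotient.mk : T → SeparationQuotient T) :=
    Isometry.of_dist_eq fun a b => SeparationQuotient.dist_mk a b
  -- The Kuratowski embedding takes values in bounded real sequences, a space in `Type`; this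
  -- removes the universe of T.
  have he := (kuratowskiEmbedding.isometry (SeparationQuotient T)).comp hmk
  refine ⟨range (kuratowskiEmbedding (SeparationQuotient T) ∘ SeparationQuotient.mk), inferInstance,
    (TopologicalSpace.isSeparable_range he.continuous).separableSpace, rangeFactorization _,
    Isometry.of_dist_eq fun a b => ?_⟩
  exact he.dist_eq a b

/-- Spaces that approximate `H` along finite sets embed in a common space in which corresponding
points are near. -/
theorem exists_common_space [∀ n, TopologicalSpace.SeparableSpace (E n)]
    [TopologicalSpace.SeparableSpace H] (a : ∀ n, ℕ → E n) (b : ℕ → ℕ → H) (N : ℕ → ℕ)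
    (hN : ∀ n, 0 < N n) (κ : ℕ → ℝ) (hκ : ∀ n, 0 < κ n)
    (hd : ∀ n, ∀ i < N n, ∀ j < N n,
      |dist (a n i) (a n j) - dist (b n i) (b n j)| ≤ 2 * κ n) :
    ∃ (Z : Type) (_ : MetricSpace Z) (_ : TopologicalSpace.SeparableSpace Z)
      (ι : ∀ n, E n → Z) (ι' : H → Z), (∀ n, Isometry (ι n)) ∧ Isometry ι' ∧
      ∀ n, ∀ j < N n, dist (ι n (a n j)) (ι' (b n j)) ≤ κ n := by
  have hne : ∀ n, Nonempty (Fin (N n)) := fun n => ⟨⟨0, hN n⟩⟩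
  have : Nonempty H := ⟨b 0 0⟩
  -- Each `E n` is first glued to H alone; only the resulting distances between `E n` and H enter
  -- the hub construction.
  let M : ∀ n, MetricSpace (E n ⊕ H) := fun n =>
    Metric.glueMetricApprox (fun i : Fin (N n) => a n i) (fun i => b n i) (κ n) (hκ n)
      fun i j => hd n i i.2 j j.2
  have hl : ∀ n (x y : E n), (M n).dist (.inl x) (.inl y) = dist x y := fun n x y => rfl
  have hr : ∀ n (x y : H), (M n).dist (.inr x) (.inr y) = dist x y := fun n x y => rfl
  obtain ⟨T, _, f, g, hf, hg, hfg, huniv⟩ := exists_pseudoMetric_sum_sigma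
    (fun n x y => (M n).dist (.inl x) (.inr y))
    (fun n x x' y => (M n).dist_triangle (.inl x) (.inl x') (.inr y))
    (fun n x y y' => by
      have := (M n).dist_triangle (.inl x) (.inr y') (.inr y)
      rwa [hr, dist_comm y'] at this)
    (fun n x x' y => by
      have := (M n).dist_triangle (.inl x) (.inr y) (.inl x')
      rwa [hl, (M n).dist_comm (.inr y)] at this)
    (fun n x y y' => by
      have := (M n).dist_triangle (.inr y) (.inl x) (.inr y')
      rwa [hr, (M n).dist_comm (.inr y)] at this)
  have : TopologicalSpace.SeparableSpace T := by
    rw [← TopologicalSpace.isSeparable_univ_iff, ← huniv]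
    exact (TopologicalSpace.isSeparable_range hg.continuous).union
      (TopologicalSpace.IsSeparable.iUnion fun n => TopologicalSpace.isSeparable_range (hf n).continuous)
  obtain ⟨Z, _, hZ, e, he⟩ := exists_isometry_separable T
  refine ⟨Z, _, hZ, fun n => e ∘ f n, e ∘ g, fun n => he.comp (hf n), he.comp hg, fun n j hj => ?_⟩
  refine (he.dist_eq _ _).le.trans ((hfg n _ _).trans (le_of_eq ?_))
  exact Metric.glueDist_glued_points (fun i : Fin (N n) => a n i) (fun i => b n i) (κ n) ⟨j, hj⟩

end hub

/-! ### Matching nets from codes -/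

/-- The factor by which distances are stretched at precision `k`. It tends to `1` more slowly than
the mesh tends to `0`, so that distances to the base point are not underestimated. -/
def stretch (k : ℕ) : ℝ := 1 + 1 / ((k : ℝ) + 1) ^ 2

theorem one_le_stretch (k : ℕ) : 1 ≤ stretch k := by
  unfold stretch
  have : 0 ≤ 1 / ((k : ℝ) + 1) ^ 2 := by positivity
  linarith

theorem stretch_pos (k : ℕ) : 0 < stretch k := zero_lt_one.trans_le (one_le_stretch k)

theorem stretch_le_two (k : ℕ) : stretch k ≤ 2 := by
  unfold stretch
  have h1 : (1 : ℝ) ≤ ((k : ℝ) + 1) ^ 2 := one_le_pow₀ (by linarith [k.cast_nonneg (α := ℝ)])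
  have : 1 / ((k : ℝ) + 1) ^ 2 ≤ 1 := (div_le_one (by positivity)).2 h1
  linarith

theorem mesh_le_one (k : ℕ) : mesh k ≤ 1 := by
  unfold mesh
  exact (div_le_one (by positivity)).2 (one_le_pow₀ (by linarith [k.cast_nonneg (α := ℝ)]))

theorem tendsto_mesh : Tendsto mesh atTop (𝓝 0) := by
  have := (tendsto_one_div_add_atTop_nhds_zero_nat (𝕜 := ℝ)).pow 4
  exact (this.congr fun k => by simp [mesh]).trans (by simp)

theorem tendsto_stretch : Tendsto stretch atTop (𝓝 1) := by
  have := ((tendsto_one_div_add_atTop_nhds_zero_nat (𝕜 := ℝ)).pow 2).const_add 1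
  exact (this.congr fun k => by simp [stretch]).trans (by simp)

/-- The distance at which corresponding points of nets are glued at precision `k`. -/
def gap (k : ℕ) : ℝ := mesh k + ((k : ℝ) + 3) / ((k : ℝ) + 1) ^ 2

theorem gap_pos (k : ℕ) : 0 < gap k := add_pos (mesh_pos k) (by positivity)

theorem tendsto_gap : Tendsto gap atTop (𝓝 0) := by
  have h1 := tendsto_one_div_add_atTop_nhds_zero_nat (𝕜 := ℝ)
  have h2 := tendsto_mesh.add (h1.add ((h1.pow 2).const_mul 2))
  simp only [ne_eq, OfNat.ofNat_ne_zero, not_false_eq_true, zero_pow, mul_zero, add_zero] at h2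
  refine h2.congr fun k => ?_
  have : (k : ℝ) + 1 ≠ 0 := by positivity
  unfold gap
  congr 1
  field_simp
  ring

/-- Finitely many points can be listed by an initial segment of a sequence with given start. -/
theorem exists_seq_of_finite {α : Type*} {t : Set α} (ht : t.Finite) (x₀ : α) :
    ∃ (b : ℕ → α) (N : ℕ), b 0 = x₀ ∧ (∀ j, b j ∈ insert x₀ t) ∧ ∀ y ∈ t, ∃ j < N, b j = y := by
  obtain ⟨f, hf⟩ := (ht.insert x₀).countable.exists_eq_range (insert_nonempty _ _)
  set b : ℕ → α := fun n => n.casesOn x₀ f with hb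
  have hex : ∀ y ∈ t, ∀ᶠ N in atTop, ∃ j < N, b j = y := by
    intro y hy
    obtain ⟨n, hn⟩ : y ∈ range f := hf ▸ mem_insert_of_mem _ hy
    filter_upwards [eventually_gt_atTop (n + 1)] with N hN
    exact ⟨n + 1, hN, hn⟩
  obtain ⟨N, hN⟩ := ((eventually_all_finite ht).2 hex).exists
  refine ⟨b, N, rfl, fun j => ?_, hN⟩
  cases j with
  | zero => exact mem_insert _ _
  | succ n => rw [hf]; exact ⟨n, rfl⟩

namespace PMMSpace

/-- Sequences whose first `N` points form nets of balls in `S` and in the stretched space `T`, with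
nearly the same mutual distances and cap masses. -/
structure NetApprox (S : PMMSpace.{u}) (T : PMMSpace.{v}) (k N : ℕ) (a : ℕ → S.supp)
    (b : ℕ → T.supp) : Prop where
  left_zero : a 0 = S.base
  right_zero : b 0 = T.base
  left_net : ∀ z : S.supp, dist z S.base < k + 1 → ∃ j < N, dist z (a j) < mesh k
  right_net : ∀ z : T.supp, stretch k * dist z T.base < k + 1 →
    ∃ j < N, stretch k * dist z (b j) < mesh k
  right_bound : ∀ j, dist (b j) T.base ≤ k + 3
  dist_near : ∀ i < N, ∀ j < N, |dist (a i) (a j) - stretch k * dist (b i) (b j)| ≤ 2 * mesh k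
  mass_near : ∀ j < N,
    |∫ z, cap (mesh k) dist a (j + 1) z ∂S.suppMeasure -
      (∫ z, cone (fun x y : T.toMMSpace => stretch k * dist x y) T.pt z ∂T.measure)⁻¹ *
        ∫ z, cap (mesh k) (fun x y => stretch k * dist x y) b (j + 1) z ∂T.suppMeasure| ≤
      2 * mesh k / (N + 1)

/-- A space with totally bounded balls realizes codes of any precision that yield nets
approximating it. -/
theorem exists_code (T : PMMSpace.{v}) (hT : T.HasTotallyBoundedBalls) (k : ℕ) :
    ∃ (N l : ℕ) (b : ℕ → T.supp), T.Sat N k l T.pt (stretch k)⁻¹ ∧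
      ∀ (X : MMSpace.{u}) (x : X) (hx : x ∈ X.supp) (r : ℝ) (hr : 0 < r), X.Sat N k l x r →
        ∃ a, NetApprox (X.rescale x hx r hr) T k N a b := by
  have hm := mesh_pos k
  have hm1 := mesh_le_one k
  have hs1 := one_le_stretch k
  have hs2 := stretch_le_two k
  -- A quarter of the mesh becomes at most half of it after stretching by at most 2; the other half
  -- is the margin required by a code.
  obtain ⟨t, htsub, htf, htcov⟩ := Metric.finite_approx_of_totallyBounded
    (T.totallyBounded_ball_base_iff.2 hT (k + 3)) (mesh k / 4) (by positivity)
  obtain ⟨b, N, hb0, hbt, hbN⟩ := exists_seq_of_finite htf T.base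
  have hnet : ∀ z : T.supp, stretch k * dist z T.base < k + 1 + mesh k / 2 →
      ∃ j < N, stretch k * dist z (b j) < mesh k - mesh k / 2 := by
    intro z hz
    have hd : 0 ≤ dist z T.base := dist_nonneg
    have hz' : dist z T.base < k + 3 := by nlinarith
    obtain ⟨y, hy, hzy⟩ := mem_iUnion₂.1 (htcov hz')
    obtain ⟨j, hj, rfl⟩ := hbN y hy
    refine ⟨j, hj, ?_⟩
    have hzy : dist z (b j) < mesh k / 4 := hzy
    nlinarith [dist_nonneg (x := z) (y := b j)]
  set dT : T.toMMSpace → T.toMMSpace → ℝ := fun x y => stretch k * dist x y with hdT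
  set DT := netData N k dT T.measure (fun j => (b j : T.toMMSpace)) with hDT
  have hη : 0 < mesh k / ((N : ℝ) + 1) := by positivity
  obtain ⟨l, hl⟩ := (TopologicalSpace.denseRange_denseSeq (NetDataSpace N)).exists_dist_lt DT hη
  refine ⟨N, l, b, ?_, ?_⟩
  · unfold MMSpace.Sat
    rw [inv_inv]
    refine ⟨fun j => b j, congrArg Subtype.val hb0, fun j => (b j).2, ⟨mesh k / 2, by positivity, ?_⟩, hl⟩
    intro z hz hzb
    exact hnet ⟨z, hz⟩ hzb
  · rintro X x hx r hr ⟨p, hp0, hpS, ⟨δ, hδ, hpnet⟩, hpdata⟩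
    have hsupp : (X.rescale x hx r hr).supp = X.supp := X.supp_normalize x hx r hr
    set a : ℕ → (X.rescale x hx r hr).supp := fun j => ⟨p j, hsupp.symm ▸ hpS j⟩ with ha
    set dX : X → X → ℝ := fun x y => r⁻¹ * dist x y with hdX
    have hdist : dist (netData N k dX X.measure p) DT < 2 * mesh k / (N + 1) := by
      refine (dist_triangle_right _ _ (TopologicalSpace.denseSeq (NetDataSpace N) l)).trans_lt ?_
      rw [mul_div_assoc, two_mul]
      exact add_lt_add hpdata hl
    have h1 := (le_max_left _ _).trans hdist.le
    have h2 := (le_max_right _ _).trans hdist.le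
    refine ⟨a, ?_, hb0, ?_, ?_, ?_, ?_, ?_⟩
    · exact Subtype.ext hp0
    · intro z hz
      obtain ⟨j, hj, hzj⟩ := hpnet z.1 (hsupp ▸ z.2) (lt_trans hz (lt_add_of_pos_right _ hδ))
      exact ⟨j, hj, lt_trans hzj (by linarith)⟩
    · intro z hz
      obtain ⟨j, hj, hzj⟩ := hnet z (by linarith)
      exact ⟨j, hj, by linarith⟩
    · intro j
      rcases hbt j with h | h
      · rw [h, dist_self]; positivity
      · exact (show dist (b j) T.base < k + 3 from htsub h).le
    · intro i hi j hj
      have h3 := (dist_le_pi_dist _ _ (⟨i, hi⟩ : Fin N)).trans h1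
      have h4 := (dist_le_pi_dist _ _ (⟨j, hj⟩ : Fin N)).trans h3
      refine (show |r⁻¹ * dist (p i) (p j) - stretch k * dist (b i : T.toMMSpace) (b j)| ≤ _ from
        h4).trans ?_
      exact div_le_self (by positivity) (by linarith [N.cast_nonneg (α := ℝ)])
    · intro j hj
      have h3 := (dist_le_pi_dist _ _ (⟨j, hj⟩ : Fin N)).trans h2
      rw [Real.dist_eq] at h3
      refine (le_of_eq ?_).trans h3
      congr 2
      · have e1 := (X.rescale x hx r hr).integral_suppMeasure (cap (mesh k) dX p (j + 1))
        refine Eq.trans ?_ (e1.trans ?_)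
        · exact integral_congr_ae (Eventually.of_forall fun z =>
            cap_congr (d := dist) (d' := dX) (q := p) (z := z) (z' := z.1) (fun j => rfl) _)
        -- The normalizing factor of the rescaled measure is the reciprocal of the cone integral by
        -- which `netData` divides.
        · change ∫ z, cap (mesh k) dX p (j + 1) z ∂((X.normConst x r)⁻¹ • X.measure) = _
          rw [integral_smul_measure, ENNReal.toReal_inv, ← X.integral_cone_eq_normConst x hr,
            smul_eq_mul, inv_mul_eq_div]
          simp only [netData, hp0, hdX]
      · rw [inv_mul_eq_div]
        have e1 := T.integral_suppMeasure (cap (mesh k) dT (fun j => (b j : T.toMMSpace)) (j + 1))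
        have e2 : ∫ z, cap (mesh k) (fun x y => stretch k * dist x y) b (j + 1) z ∂T.suppMeasure =
            ∫ z, cap (mesh k) dT (fun j => (b j : T.toMMSpace)) (j + 1) z ∂T.measure := by
          rw [← e1]
          exact integral_congr_ae (Eventually.of_forall fun z =>
            cap_congr (d := fun x y : T.supp => stretch k * dist x y) (d' := dT)
              (q := fun j => (b j : T.toMMSpace)) (z := z) (z' := z.1) (fun j => rfl) _)
        rw [e2]
        simp only [hDT, netData, hb0]
        rfl

theorem tendsto_integral_cone_stretch (T : PMMSpace.{v})
    (h : ∫ z, cone (fun a b : T.toMMSpace => (1 : ℝ)⁻¹ * dist a b) T.pt z ∂T.measure = 1) :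
    Tendsto (fun k => ∫ z, cone (fun x y : T.toMMSpace => stretch k * dist x y) T.pt z ∂T.measure)
      atTop (𝓝 1) := by
  rw [← h]
  refine tendsto_integral_of_dominated_convergence _ (fun k => ?_)
    -- The limit cone dominates because stretching shrinks cones; it is integrable since its
    -- integral is not 0.
    (integrable_of_integral_eq_one h) (fun k => Eventually.of_forall fun z => ?_)
    (Eventually.of_forall fun z => ?_)
  · have : Continuous (cone (fun x y : T.toMMSpace => stretch k * dist x y) T.pt) := by
      unfold cone; fun_prop
    exact this.measurable.aestronglyMeasurable
  · rw [Real.norm_eq_abs, abs_of_nonneg (cone_nonneg _ _ _)]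
    refine max_le_max_left _ ?_
    rw [inv_one]
    have := mul_le_mul_of_nonneg_right (one_le_stretch k) (dist_nonneg (x := z) (y := T.pt))
    linarith
  · rw [show (1 : ℝ)⁻¹ = 1 from inv_one]
    exact tendsto_const_nhds.max (tendsto_const_nhds.sub (tendsto_stretch.mul_const _))

end PMMSpace

/-! ### Integrals as weighted sums over nets -/

theorem integrable_cap {E : Type*} [MetricSpace E] [MeasurableSpace E] [BorelSpace E]
    {ν : Measure E} (hν : ∀ s, Bornology.IsBounded s → ν s < ⊤) {ε σ : ℝ} (hε : 0 < ε)
    (hσ : 0 < σ) {d : E → E → ℝ} (hd : ∀ x y, d x y = σ * dist x y) (p : ℕ → E) (j : ℕ) :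
    Integrable (cap ε d p j) ν := by
  induction j with
  | zero => exact integrable_zero _ _ _
  | succ j ih =>
    refine ih.sup (integrable_of_isBounded_support hν (M := 1) ?_ (fun z => ?_) ?_)
    · simp only [hd]
      exact (continuous_tent ε).comp (by fun_prop)
    · rw [abs_of_nonneg (tent_nonneg _ _)]; exact tent_le_one _ _
    · refine (Metric.isBounded_ball (x := p j) (r := σ⁻¹ * (2 * ε))).subset fun z hz => ?_
      have := lt_of_tent_ne_zero hε hz
      rw [hd] at this
      exact (lt_inv_mul_iff₀ hσ).2 this

/-- An integral is approximated by a sum over a net, weighted by the increments of the caps. -/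
theorem abs_integral_sub_sum_le {E : Type*} [MetricSpace E] [MeasurableSpace E] [BorelSpace E]
    {ν : Measure E} {ε ω : ℝ} (hε : 0 < ε) {d : E → E → ℝ} {p : ℕ → E}
    (hint : ∀ j, Integrable (cap ε d p j) ν) {f : E → ℝ} (hf : Integrable f ν) {c : ℕ → ℝ} {N : ℕ}
    {B : Set E} (hB : MeasurableSet B) (hBfin : ν B < ⊤)
    (h1 : ∀ z, ∀ j < N, d z (p j) < 2 * ε → |f z - c j| ≤ ω)
    (h2 : ∀ z ∈ B, ∃ j < N, d z (p j) ≤ ε)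
    (h3 : ∀ z, z ∉ B → f z = 0 ∧ ∀ j < N, d z (p j) < 2 * ε → c j = 0) :
    |∫ z, f z ∂ν - ∑ j ∈ Finset.range N,
      c j * (∫ z, cap ε d p (j + 1) z ∂ν - ∫ z, cap ε d p j z ∂ν)| ≤ ω * ν.real B := by
  set ψ : ℕ → E → ℝ := fun j z => cap ε d p (j + 1) z - cap ε d p j z with hψ
  have hψint : ∀ j, Integrable (ψ j) ν := fun j => (hint _).sub (hint _)
  have hψ0 : ∀ j z, 0 ≤ ψ j z := fun j z => sub_nonneg.2 (cap_le_cap_succ j z)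
  have hsum : ∑ j ∈ Finset.range N, c j * (∫ z, cap ε d p (j + 1) z ∂ν - ∫ z, cap ε d p j z ∂ν) =
      ∫ z, ∑ j ∈ Finset.range N, c j * ψ j z ∂ν := by
    rw [integral_finsetSum _ fun j _ => (hψint j).const_mul _]
    refine Finset.sum_congr rfl fun j _ => ?_
    rw [integral_const_mul, integral_sub (hint _) (hint _)]
  have hpt : ∀ z, |f z - ∑ j ∈ Finset.range N, c j * ψ j z| ≤ B.indicator (fun _ => ω) z := by
    intro z
    by_cases hz : z ∈ B
    · rw [indicator_of_mem hz]
      -- Telescoping: the sum is the full cap, which is 1 wherever the net is within ε.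
      have hone : ∑ j ∈ Finset.range N, ψ j z = 1 := by
        rw [hψ, Finset.sum_range_sub (fun j => cap ε d p j z), cap_eq_one hε (h2 z hz)]
        simp [cap]
      have heq : f z - ∑ j ∈ Finset.range N, c j * ψ j z =
          ∑ j ∈ Finset.range N, (f z - c j) * ψ j z := by
        simp only [sub_mul, Finset.sum_sub_distrib, ← Finset.mul_sum, hone, mul_one]
      rw [heq]
      calc |∑ j ∈ Finset.range N, (f z - c j) * ψ j z|
          ≤ ∑ j ∈ Finset.range N, |(f z - c j) * ψ j z| := Finset.abs_sum_le_sum_abs _ _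
        _ ≤ ∑ j ∈ Finset.range N, ω * ψ j z := by
          refine Finset.sum_le_sum fun j hj => ?_
          rw [abs_mul, abs_of_nonneg (hψ0 j z)]
          by_cases h0 : ψ j z = 0
          · simp [h0]
          · exact mul_le_mul_of_nonneg_right
              (h1 z j (Finset.mem_range.1 hj) (lt_of_cap_succ_ne hε h0)) (hψ0 j z)
        _ = ω := by rw [← Finset.mul_sum, hone, mul_one]
    · rw [indicator_of_notMem hz, (h3 z hz).1, Finset.sum_eq_zero, sub_zero, abs_zero]
      intro j hj
      by_cases h0 : ψ j z = 0
      · rw [h0, mul_zero]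
      · rw [(h3 z hz).2 j (Finset.mem_range.1 hj) (lt_of_cap_succ_ne hε h0), zero_mul]
  rw [hsum, ← integral_sub hf (integrable_finsetSum _ fun j _ => (hψint j).const_mul _)]
  have hind : Integrable (B.indicator fun _ => ω) ν :=
    (integrable_indicator_iff hB).2 (integrableOn_const hBfin.ne)
  refine (norm_integral_le_of_norm_le hind
    (Eventually.of_forall fun z => (Real.norm_eq_abs _).trans_le (hpt z))).trans (le_of_eq ?_)
  rw [integral_indicator hB, setIntegral_const, smul_eq_mul, mul_comm]

namespace PMMSpace

theorem isCompact_closedBall_base (T : PMMSpace.{v}) (hT : T.HasTotallyBoundedBalls) (R : ℝ) :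
    IsCompact (Metric.closedBall T.base R) := by
  have : CompleteSpace T.supp := T.isClosed_supp.completeSpace_coe
  refine isCompact_iff_totallyBounded_isComplete.2 ⟨?_, Metric.isClosed_closedBall.isComplete⟩
  exact (T.totallyBounded_ball_base_iff.2 hT (R + 1)).subset
    (Metric.closedBall_subset_ball (by linarith))

/-- A continuous function with bounded support is uniformly continuous near a properly embedded
space. -/
theorem exists_uniform_near (T : PMMSpace.{v}) (hT : T.HasTotallyBoundedBalls) {Z : Type w}
    [MetricSpace Z] {ι' : T.supp → Z} (hι' : Isometry ι') {φ : Z → ℝ} (hφ : Continuous φ) {R : ℝ}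
    (hR : ∀ z, R < dist z (ι' T.base) → φ z = 0) {ω : ℝ} (hω : 0 < ω) :
    ∃ δ > 0, ∀ (y : T.supp) (z : Z), dist z (ι' y) < δ → |φ z - φ (ι' y)| ≤ ω := by
  have hK := (T.isCompact_closedBall_base hT (R + 1)).image hι'.continuous
  obtain ⟨δ, hδ, h⟩ := Metric.mem_uniformity_dist.1 (hK.uniformContinuousAt_of_continuousAt φ
    (fun z _ => hφ.continuousAt) (Metric.dist_mem_uniformity hω))
  refine ⟨min δ 1, lt_min hδ one_pos, fun y z hz => ?_⟩
  -- On the compact ball of radius R + 1 continuity is uniform, even towards points off the image;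
  -- beyond it both values vanish.
  by_cases hy : dist y T.base ≤ R + 1
  · have h1 := @h (ι' y) z (by rw [dist_comm]; exact hz.trans_le (min_le_left _ _)) ⟨y, hy, rfl⟩
    rw [← Real.dist_eq, dist_comm]
    exact (show dist (φ (ι' y)) (φ z) < ω from h1).le
  · have h1 := dist_triangle_left (ι' y) (ι' T.base) z
    rw [hι'.dist_eq] at h1
    have h2 := hz.trans_le (min_le_right _ _)
    rw [hR z (by linarith), hR (ι' y) (by rw [hι'.dist_eq]; linarith), sub_zero, abs_zero]
    exact hω.le

end PMMSpace

namespace PMMSpace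

/-- Integrals of a function with bounded support nearly agree on spaces with approximating nets. -/
theorem NetApprox.abs_integral_sub_le {S : PMMSpace.{u}} {T : PMMSpace.{v}} {k N : ℕ}
    {a : ℕ → S.supp} {b : ℕ → T.supp} (h : NetApprox S T k N a b) {Z : Type w} [MetricSpace Z]
    {ι : S.supp → Z} {ι' : T.supp → Z} (hι : Isometry ι) (hι' : Isometry ι')
    (hgap : ∀ j < N, dist (ι (a j)) (ι' (b j)) ≤ gap k) {φ : Z → ℝ} (hφ : Continuous φ) {M R : ℝ}
    (hM : ∀ z, |φ z| ≤ M) (hR0 : 0 < R) (hR : ∀ z, R < dist z (ι' T.base) → φ z = 0) {δ ω : ℝ}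
    (hδ : ∀ (y : T.supp) (z : Z), dist z (ι' y) < δ → |φ z - φ (ι' y)| ≤ ω)
    (hkδ : 2 * mesh k + gap k < δ) (hk1 : 2 * mesh k + gap k < 1) (hkR : 2 * (R + 3) < k + 1)
    {c : ℝ} (hc0 : 0 ≤ c)
    (hc : c = (∫ z, cone (fun x y : T.toMMSpace => stretch k * dist x y) T.pt z ∂T.measure)⁻¹) :
    |∫ z, φ (ι z) ∂S.suppMeasure - c * ∫ z, φ (ι' z) ∂T.suppMeasure| ≤
      ω * (S.suppMeasure.real (Metric.ball S.base (R + 3)) +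
        c * T.suppMeasure.real (Metric.ball T.base (R + 3))) + M * (4 * mesh k) := by
  have hm := mesh_pos k
  have hg := gap_pos k
  have hs1 := one_le_stretch k
  have hs2 := stretch_le_two k
  have hM0 : 0 ≤ M := (abs_nonneg _).trans (hM (ι' T.base))
  have hN : 0 < N := by
    obtain ⟨j, hj, -⟩ := h.left_net S.base (by rw [dist_self]; positivity)
    omega
  have hbase : dist (ι S.base) (ι' T.base) ≤ gap k := by
    rw [← h.left_zero, ← h.right_zero]; exact hgap 0 hN
  have hbd : Bornology.IsBounded (Function.support φ) :=
    (Metric.isBounded_closedBall (x := ι' T.base) (r := R)).subset fun z hz => by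
      by_contra hc; exact hz (hR z (not_le.1 hc))
  have hφS : Integrable (fun z => φ (ι z)) S.suppMeasure :=
    integrable_of_isBounded_support S.suppMeasure_lt_top (hφ.comp hι.continuous) (fun z => hM _)
      (hι.antilipschitz.isBounded_preimage hbd)
  have hφT : Integrable (fun z => φ (ι' z)) T.suppMeasure :=
    integrable_of_isBounded_support T.suppMeasure_lt_top (hφ.comp hι'.continuous) (fun z => hM _)
      (hι'.antilipschitz.isBounded_preimage hbd)
  have hcoef : ∀ j, ∀ z : Z, R + 2 ≤ dist z (ι' T.base) → dist z (ι' (b j)) < 1 →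
      φ (ι' (b j)) = 0 := fun j z h1 h2 => hR _ (by
    have := dist_triangle z (ι' (b j)) (ι' T.base)
    linarith)
  -- Both integrals are compared with sums having the same coefficients, the values of φ at the
  -- points of the net of T, so that only the cap masses differ.
  have eS := abs_integral_sub_sum_le (ν := S.suppMeasure) (ω := ω) hm (d := dist) (p := a)
    (integrable_cap S.suppMeasure_lt_top hm one_pos (fun x y => (one_mul _).symm) a) hφS
    (c := fun j => φ (ι' (b j))) (N := N) (B := Metric.ball S.base (R + 3))
    Metric.isOpen_ball.measurableSet (S.suppMeasure_lt_top _ Metric.isBounded_ball)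
    (fun z j hj hz => by
      refine hδ _ _ ?_
      have := dist_triangle (ι z) (ι (a j)) (ι' (b j))
      rw [hι.dist_eq] at this
      linarith [hgap j hj])
    (fun z hz => by
      have hz : dist z S.base < R + 3 := hz
      obtain ⟨j, hj, hzj⟩ := h.left_net z (by linarith)
      exact ⟨j, hj, hzj.le⟩)
    (fun z hz => by
      have hz : R + 3 ≤ dist z S.base := not_lt.1 hz
      have h1 : R + 2 ≤ dist (ι z) (ι' T.base) := by
        have := dist_triangle_right (ι z) (ι S.base) (ι' T.base)
        rw [hι.dist_eq] at this
        linarith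
      refine ⟨hR _ (by linarith), fun j hj hzj => hcoef j (ι z) h1 ?_⟩
      have := dist_triangle (ι z) (ι (a j)) (ι' (b j))
      rw [hι.dist_eq] at this
      linarith [hgap j hj])
  have hshrink : ∀ {t r : ℝ}, 0 ≤ t → stretch k * t < r → t < r := fun ht h =>
    (le_mul_of_one_le_left ht hs1).trans_lt h
  have eT := abs_integral_sub_sum_le (ν := T.suppMeasure) (ω := ω) hm
    (d := fun x y => stretch k * dist x y) (p := b)
    (integrable_cap T.suppMeasure_lt_top hm (stretch_pos k) (fun x y => rfl) b) hφT
    (c := fun j => φ (ι' (b j))) (N := N) (B := Metric.ball T.base (R + 3))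
    Metric.isOpen_ball.measurableSet (T.suppMeasure_lt_top _ Metric.isBounded_ball)
    (fun z j hj hz => by
      refine hδ _ _ ?_
      rw [hι'.dist_eq]
      linarith [hshrink dist_nonneg hz])
    (fun z hz => by
      have hz : dist z T.base < R + 3 := hz
      obtain ⟨j, hj, hzj⟩ := h.right_net z (by nlinarith [dist_nonneg (x := z) (y := T.base)])
      exact ⟨j, hj, hzj.le⟩)
    (fun z hz => by
      have hz : R + 3 ≤ dist z T.base := not_lt.1 hz
      have h1 : R + 2 ≤ dist (ι' z) (ι' T.base) := by rw [hι'.dist_eq]; linarith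
      refine ⟨hR _ (by linarith), fun j hj hzj => hcoef j (ι' z) h1 ?_⟩
      rw [hι'.dist_eq]
      linarith [hshrink dist_nonneg hzj])
  set A : ℕ → ℝ := fun j => ∫ z, cap (mesh k) dist a j z ∂S.suppMeasure with hA
  set B : ℕ → ℝ := fun j => ∫ z, cap (mesh k) (fun x y => stretch k * dist x y) b j z
    ∂T.suppMeasure with hB
  have hmass : ∀ j ≤ N, |A j - c * B j| ≤ 2 * mesh k / (N + 1) := by
    intro j hj
    cases j with
    | zero =>
      simp only [hA, hB, cap, integral_zero, mul_zero, sub_zero, abs_zero]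
      positivity
    | succ j => rw [hc]; exact h.mass_near j hj
  have hsum : |∑ j ∈ Finset.range N, φ (ι' (b j)) * (A (j + 1) - A j) -
      c * ∑ j ∈ Finset.range N, φ (ι' (b j)) * (B (j + 1) - B j)| ≤ M * (4 * mesh k) := by
    rw [Finset.mul_sum, ← Finset.sum_sub_distrib]
    refine (Finset.abs_sum_le_sum_abs _ _).trans ?_
    -- Each of the N terms carries two cap masses, which is why codes are accurate up to the mesh
    -- divided by N + 1.
    have hterm : ∀ j ∈ Finset.range N, |φ (ι' (b j)) * (A (j + 1) - A j) -
        c * (φ (ι' (b j)) * (B (j + 1) - B j))| ≤ M * (4 * mesh k / (N + 1)) := by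
      intro j hj
      have hj := Finset.mem_range.1 hj
      rw [show φ (ι' (b j)) * (A (j + 1) - A j) - c * (φ (ι' (b j)) * (B (j + 1) - B j)) =
        φ (ι' (b j)) * ((A (j + 1) - c * B (j + 1)) - (A j - c * B j)) by ring, abs_mul]
      refine mul_le_mul (hM _) ?_ (abs_nonneg _) hM0
      refine (abs_sub _ _).trans ?_
      have := add_le_add (hmass (j + 1) hj) (hmass j hj.le)
      refine this.trans (le_of_eq (by ring))
    refine (Finset.sum_le_sum hterm).trans ?_
    rw [Finset.sum_const, Finset.card_range, nsmul_eq_mul]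
    have h1 : (N : ℝ) * (4 * mesh k / (N + 1)) ≤ 4 * mesh k := by
      rw [mul_div_assoc', div_le_iff₀ (by positivity)]
      nlinarith
    calc (N : ℝ) * (M * (4 * mesh k / (N + 1))) = M * ((N : ℝ) * (4 * mesh k / (N + 1))) := by ring
      _ ≤ _ := mul_le_mul_of_nonneg_left h1 hM0
  have eT' := mul_le_mul_of_nonneg_left eT hc0
  rw [← abs_of_nonneg hc0, ← abs_mul, abs_of_nonneg hc0] at eT'
  rw [abs_le] at eS eT' hsum ⊢
  constructor <;> nlinarith [eS.1, eS.2, eT'.1, eT'.2, hsum.1, hsum.2]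

/-! ### Convergence from matching nets -/

/-- Approximating nets of increasing precision give convergence. -/
theorem converges_of_netApprox {S : ℕ → PMMSpace.{u}} {T : PMMSpace.{v}}
    (hT : T.HasTotallyBoundedBalls)
    (hnorm : ∫ z, cone (fun a b : T.toMMSpace => (1 : ℝ)⁻¹ * dist a b) T.pt z ∂T.measure = 1)
    (hL : ∀ R, ∃ L : ℝ, ∀ k, (S k).suppMeasure.real (Metric.ball (S k).base R) ≤ L)
    {N : ℕ → ℕ} {a : ∀ k, ℕ → (S k).supp} {b : ℕ → ℕ → T.supp}
    (h : ∀ k, NetApprox (S k) T k (N k) (a k) (b k)) : Converges S T := by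
  have hsep : ∀ X : MMSpace.{u}, TopologicalSpace.SeparableSpace X.supp := fun X => by
    have := UniformSpace.secondCountable_of_separable X.carrier
    infer_instance
  have hsep' : TopologicalSpace.SeparableSpace T.supp := by
    have := UniformSpace.secondCountable_of_separable T.carrier
    infer_instance
  have hN : ∀ k, 0 < N k := fun k => by
    obtain ⟨j, hj, -⟩ := (h k).left_net (S k).base (by rw [dist_self]; positivity)
    omega
  obtain ⟨Z, _, hZ, ι, ι', hι, hι', hgap⟩ := exists_common_space (E := fun k => (S k).supp) a b N hN
    -- Undoing the stretch changes distances of at most 2 (k + 3) by at most 2 (k + 3) / (k + 1)².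
    -- With the error 2 `mesh k` this is twice the gap.
    gap gap_pos (fun k i hi j hj => by
      have h1 := (h k).dist_near i hi j hj
      have h2 : stretch k * dist (b k i) (b k j) - dist (b k i) (b k j) =
          1 / ((k : ℝ) + 1) ^ 2 * dist (b k i) (b k j) := by unfold stretch; ring
      have h3 : dist (b k i) (b k j) ≤ 2 * (k + 3) := by
        linarith [dist_triangle_right (b k i) (b k j) T.base, (h k).right_bound i,
          (h k).right_bound j]
      have h4 : 1 / ((k : ℝ) + 1) ^ 2 * dist (b k i) (b k j) ≤
          2 * ((k + 3) / ((k : ℝ) + 1) ^ 2) := by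
        refine (mul_le_mul_of_nonneg_left h3 (by positivity)).trans (le_of_eq (by ring))
      have h5 : 0 ≤ 1 / ((k : ℝ) + 1) ^ 2 * dist (b k i) (b k j) := by positivity
      rw [abs_le] at h1 ⊢
      unfold gap
      constructor <;> linarith [h1.1, h1.2])
  have hbase : ∀ k, dist (ι k (S k).base) (ι' T.base) ≤ gap k := fun k => by
    rw [← (h k).left_zero, ← (h k).right_zero]; exact hgap k 0 (hN k)
  have hkinf : Tendsto (fun k : ℕ => (k : ℝ) + 1) atTop atTop :=
    tendsto_atTop_add_const_right _ _ tendsto_natCast_atTop_atTop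
  let mZ : MeasurableSpace Z := borel Z
  have bZ : BorelSpace Z := ⟨rfl⟩
  refine ⟨Z, _, hZ, mZ, bZ, ι, ι', hι, hι', fun ε hε R hR => ?_, fun φ hφ ⟨M, hM⟩ hbd => ?_⟩
  · have e1 : ∀ᶠ k in atTop, ∀ x ∈ Metric.ball (S k).base R,
        ∃ y ∈ Metric.ball T.base R, dist (ι k x) (ι' y) < ε := by
      have h1 : ∀ᶠ k in atTop, mesh k + gap k < ε := by
        have := tendsto_mesh.add tendsto_gap
        rw [add_zero] at this
        exact this.eventually_lt_const hε
      have h2 : ∀ᶠ k : ℕ in atTop, 3 / R < (k : ℝ) + 1 := hkinf.eventually_gt_atTop _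
      filter_upwards [h1, h2, hkinf.eventually_gt_atTop R] with k h1 h2 h3 x hx
      obtain ⟨j, hj, hxj⟩ := (h k).left_net x (lt_trans hx h3)
      have hx : dist x (S k).base < R := hx
      refine ⟨b k j, ?_, ?_⟩
      · have h4 := (h k).dist_near j hj 0 (hN k)
        rw [(h k).left_zero, (h k).right_zero, abs_le] at h4
        have h5 := dist_triangle_left (a k j) (S k).base x
        -- The purpose of the stretch: its gain R / (k + 1)² at radius R absorbs the error 3 / (k +
        -- 1)⁴ of the net, so that `b k j` stays inside the open ball of the same radius R.
        have h6 : 3 * mesh k ≤ R * (1 / ((k : ℝ) + 1) ^ 2) := by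
          have hk0 : (0 : ℝ) < (k : ℝ) + 1 := by positivity
          have hk1 : (1 : ℝ) ≤ (k : ℝ) + 1 := by linarith [k.cast_nonneg (α := ℝ)]
          have h7 : 3 < ((k : ℝ) + 1) * R := (div_lt_iff₀ hR).1 h2
          unfold mesh
          rw [mul_one_div, mul_one_div, div_le_div_iff₀ (by positivity) (by positivity)]
          have h8 : 3 ≤ R * ((k : ℝ) + 1) ^ 2 := by nlinarith
          nlinarith [sq_nonneg ((k : ℝ) + 1)]
        have h7 : stretch k * dist (b k j) T.base < stretch k * R := by
          have : stretch k * R = R + R * (1 / ((k : ℝ) + 1) ^ 2) := by unfold stretch; ring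
          linarith [h4.1]
        exact lt_of_mul_lt_mul_left h7 (stretch_pos k).le
      · have h4 := dist_triangle (ι k x) (ι k (a k j)) (ι' (b k j))
        rw [(hι k).dist_eq] at h4
        linarith [hgap k j hj]
    have e2 : ∀ᶠ k in atTop, ∀ y ∈ Metric.ball T.base R,
        ∃ x ∈ Metric.ball (S k).base R, dist (ι' y) (ι k x) < ε := by
      -- In this direction finitely many points suffice; each has distance strictly below R from the
      -- base point, which leaves room for the errors.
      obtain ⟨t, htsub, htf, htcov⟩ := Metric.finite_approx_of_totallyBounded
        (T.totallyBounded_ball_base_iff.2 hT R) (ε / 2) (half_pos hε)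
      have h0 : ∀ᶠ k in atTop, ∀ y ∈ t,
          ∃ x ∈ Metric.ball (S k).base R, dist (ι' y) (ι k x) < ε / 2 := by
        refine (eventually_all_finite htf).2 fun y hy => ?_
        have hyR : dist y T.base < R := htsub hy
        have h1 : ∀ᶠ k in atTop, mesh k + gap k < ε / 2 := by
          have := tendsto_mesh.add tendsto_gap
          rw [add_zero] at this
          exact this.eventually_lt_const (half_pos hε)
        have h2 : ∀ᶠ k in atTop, stretch k * dist y T.base + 3 * mesh k < R := by
          have := (tendsto_stretch.mul_const (dist y T.base)).add (tendsto_mesh.const_mul 3)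
          rw [one_mul, mul_zero, add_zero] at this
          exact this.eventually_lt_const hyR
        filter_upwards [h1, h2, hkinf.eventually_gt_atTop (2 * R)] with k h1 h2 h3
        have hs2 := stretch_le_two k
        have hs1 := one_le_stretch k
        obtain ⟨j, hj, hyj⟩ := (h k).right_net y (by nlinarith [dist_nonneg (x := y) (y := T.base)])
        refine ⟨a k j, ?_, ?_⟩
        · have h4 := (h k).dist_near j hj 0 (hN k)
          rw [(h k).left_zero, (h k).right_zero, abs_le] at h4
          have h5 := mul_le_mul_of_nonneg_left (dist_triangle_left (b k j) T.base y)
            (stretch_pos k).le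
          change dist (a k j) (S k).base < R
          linarith [h4.2]
        · have h4 := dist_triangle_right (ι' y) (ι k (a k j)) (ι' (b k j))
          rw [hι'.dist_eq] at h4
          have h5 : dist y (b k j) ≤ stretch k * dist y (b k j) :=
            le_mul_of_one_le_left dist_nonneg hs1
          linarith [hgap k j hj]
      filter_upwards [h0] with k hk y hy
      obtain ⟨y', hy', hyy'⟩ := mem_iUnion₂.1 (htcov hy)
      obtain ⟨x, hx, hd⟩ := hk y' hy'
      refine ⟨x, hx, ?_⟩
      have h1 := dist_triangle (ι' y) (ι' y') (ι k x)
      rw [hι'.dist_eq] at h1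
      have hyy' : dist y y' < ε / 2 := hyy'
      linarith
    obtain ⟨k₀, hk₀⟩ := eventually_atTop.1 (e1.and e2)
    refine ⟨k₀, fun k hk => ⟨?_, ?_⟩⟩
    · rintro _ ⟨y, hy, rfl⟩
      obtain ⟨x, hx, hd⟩ := (hk₀ k hk.le).2 y hy
      exact Metric.mem_thickening_iff.2 ⟨_, ⟨x, hx, rfl⟩, hd⟩
    · rintro _ ⟨x, hx, rfl⟩
      obtain ⟨y, hy, hd⟩ := (hk₀ k hk.le).1 x hx
      exact Metric.mem_thickening_iff.2 ⟨_, ⟨y, hy, rfl⟩, hd⟩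
  · obtain ⟨R, hR0, hRsub⟩ := hbd.subset_closedBall_lt 0 (ι' T.base)
    have hR : ∀ z, R < dist z (ι' T.base) → φ z = 0 := fun z hz => by
      by_contra hc
      exact absurd (hRsub hc) (not_le.2 hz)
    have hM0 : 0 ≤ M := (abs_nonneg _).trans (hM (ι' T.base))
    obtain ⟨L, hL⟩ := hL (R + 3)
    have hL0 : 0 ≤ L := measureReal_nonneg.trans (hL 0)
    set V := T.suppMeasure.real (Metric.ball T.base (R + 3)) with hV
    have hV0 : 0 ≤ V := measureReal_nonneg
    set c : ℕ → ℝ := fun k =>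
      (∫ z, cone (fun x y : T.toMMSpace => stretch k * dist x y) T.pt z ∂T.measure)⁻¹ with hcdef
    have hc0 : ∀ k, 0 ≤ c k := fun k => inv_nonneg.2 (integral_nonneg fun z => cone_nonneg _ _ _)
    have hc : Tendsto c atTop (𝓝 1) := by
      have := (T.tendsto_integral_cone_stretch hnorm).inv₀ one_ne_zero
      rwa [inv_one] at this
    simp only [integral_pushforward _ (hι _) hφ, integral_pushforward _ hι' hφ]
    have hdiff : Tendsto (fun k => ∫ z, φ (ι k z) ∂(S k).suppMeasure -
        c k * ∫ z, φ (ι' z) ∂T.suppMeasure) atTop (𝓝 0) := by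
      refine Metric.tendsto_nhds.2 fun η hη => ?_
      -- The masses add up to at most L + 2 V once `c k` is below 2, so the oscillation contributes
      -- at most η / 2.
      set ω := η / (2 * (L + 2 * V + 1)) with hω
      have hω0 : 0 < ω := by positivity
      obtain ⟨δ, hδ, hnear⟩ := T.exists_uniform_near hT hι' hφ hR hω0
      have h1 : Tendsto (fun k => 2 * mesh k + gap k) atTop (𝓝 0) := by
        simpa using (tendsto_mesh.const_mul 2).add tendsto_gap
      have h2 : Tendsto (fun k => M * (4 * mesh k)) atTop (𝓝 0) := by
        simpa using (tendsto_mesh.const_mul 4).const_mul M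
      filter_upwards [h1.eventually_lt_const hδ, h1.eventually_lt_const one_pos,
        h2.eventually_lt_const (half_pos hη), hkinf.eventually_gt_atTop (2 * (R + 3)),
        hc.eventually_lt_const one_lt_two] with k k1 k2 k3 k4 k5
      rw [Real.dist_0_eq_abs]
      refine ((h k).abs_integral_sub_le (hι k) hι' (hgap k) hφ hM hR0 hR hnear k1 k2 k4 (hc0 k)
        rfl).trans_lt ?_
      have h3 : (S k).suppMeasure.real (Metric.ball (S k).base (R + 3)) + c k * V ≤
          L + 2 * V + 1 := by
        have := mul_le_mul_of_nonneg_right k5.le hV0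
        linarith [hL k]
      have h4 := mul_le_mul_of_nonneg_left h3 hω0.le
      have h5 : ω * (L + 2 * V + 1) = η / 2 := by
        rw [hω]; field_simp
      linarith
    have hlim := hdiff.add (hc.mul_const (∫ z, φ (ι' z) ∂T.suppMeasure))
    rw [zero_add, one_mul] at hlim
    exact hlim.congr fun k => sub_add_cancel _ _

theorem Converges.comp_strictMono {S : ℕ → PMMSpace.{u}} {T : PMMSpace.{v}} (h : Converges S T)
    {g : ℕ → ℕ} (hg : StrictMono g) : Converges (fun i => S (g i)) T := by
  obtain ⟨Z, i1, i2, i3, i4, ι, ι', h1, h2, h3, h4⟩ := h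
  refine ⟨Z, i1, i2, i3, i4, fun i => ι (g i), ι', fun i => h1 _, h2, fun ε hε R hR => ?_,
    fun φ hφ hM hb => (h4 φ hφ hM hb).comp hg.tendsto_atTop⟩
  obtain ⟨i₀, hi⟩ := h3 ε hε R hR
  exact ⟨i₀, fun i hi' => hi (g i) (hi'.trans_le (hg.id_le i))⟩

end PMMSpace

/-! ### Tangents from realized codes -/

/-- A positive null sequence has a nonincreasing subsequence. -/
theorem exists_strictMono_antitone {r : ℕ → ℝ} (hr : ∀ i, 0 < r i) (h0 : Tendsto r atTop (𝓝 0)) :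
    ∃ g : ℕ → ℕ, StrictMono g ∧ Antitone (r ∘ g) := by
  obtain ⟨g, hg | hg⟩ := exists_increasing_or_nonincreasing_subseq (fun x y : ℝ => y ≤ x) r
  · refine ⟨g, g.strictMono, fun m n hmn => ?_⟩
    rcases hmn.eq_or_lt with rfl | h
    · exact le_rfl
    · exact hg m n h
  -- In the other alternative all later terms exceed the first one, which is positive, and the limit
  -- cannot be 0.
  · have h1 : Tendsto (r ∘ g) atTop (𝓝 0) := h0.comp g.strictMono.tendsto_atTop
    obtain ⟨n, hn, hn0⟩ := ((h1.eventually_lt_const (hr (g 0))).and (eventually_gt_atTop 0)).exists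
    exact absurd hn.le (hg 0 n hn0)

namespace MMSpace

/-- A normalized space all of whose codes are realized at arbitrarily small scales is a tangent. -/
theorem isTangent_of_forall_sat {X : MMSpace.{u}} {C : ℝ → ℝ} (hX : X.IsBoundedlyDoubling C) {x : X}
    {W : PMMSpace.{w}} (hW : W.HasTotallyBoundedBalls)
    (hnorm : ∫ z, cone (fun a b : W.toMMSpace => (1 : ℝ)⁻¹ * dist a b) W.pt z ∂W.measure = 1)
    (h : ∀ (N k l : ℕ) (s : ℝ), 0 < s → W.Sat N k l W.pt s →
      ∀ η > 0, ∃ r, 0 < r ∧ r < η ∧ X.Sat N k l x r) : X.IsTangent x W := by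
  have hx := hX.mem_supp x
  have hex : ∀ k : ℕ, ∃ (N : ℕ) (b : ℕ → W.supp) (r : ℝ) (hr : 0 < r), r < 1 / ((k : ℝ) + 1) ∧
      ∃ a, PMMSpace.NetApprox (X.rescale x hx r hr) W k N a b := by
    intro k
    obtain ⟨N, l, b, hsat, hb⟩ := PMMSpace.exists_code.{u, w} W hW k
    -- The stretched copy of W is W seen at scale `(stretch k)⁻¹`, so codes at scales other than 1
    -- are needed.
    obtain ⟨r, hr, hrk, hsat'⟩ := h N k l _ (inv_pos.2 (stretch_pos k)) hsat
      (1 / ((k : ℝ) + 1)) (by positivity)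
    exact ⟨N, b, r, hr, hrk, hb X x hx r hr hsat'⟩
  choose N b r hr hrk a hab using hex
  have hr1 : ∀ k, r k < 1 := fun k => (hrk k).trans_le
    ((div_le_one (by positivity)).2 (by linarith [k.cast_nonneg (α := ℝ)]))
  have hr0 : Tendsto r atTop (𝓝 0) :=
    squeeze_zero (fun k => (hr k).le) (fun k => (hrk k).le)
      (tendsto_one_div_add_atTop_nhds_zero_nat (𝕜 := ℝ))
  have hconv := PMMSpace.converges_of_netApprox (S := fun k => X.rescale x hx (r k) (hr k)) hW hnorm
    (fun R => by
      obtain ⟨L, hLt, hL⟩ := hX.exists_measure_ball_le R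
      refine ⟨L.toReal, fun k => ENNReal.toReal_mono hLt (le_trans ?_ (hL x (r k) (hr k) (hr1 k)))⟩
      refine (MeasurableEmbedding.comap_apply (MeasurableEmbedding.subtype_coe
        (X.rescale x hx (r k) (hr k)).isClosed_supp.measurableSet) _ _).trans_le ?_
      change (X.normConst x (r k))⁻¹ * X.measure _ ≤ _
      refine mul_le_mul_right (measure_mono ?_) _
      rintro _ ⟨z, hz, rfl⟩
      have hz' : (r k)⁻¹ * @dist X _ z.1 x < R := hz
      exact (inv_mul_lt_iff₀ (hr k)).1 hz') hab
  -- The radii found for successive k need not be monotone, as the definition of a tangent requires.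
  obtain ⟨g, hg, hanti⟩ := exists_strictMono_antitone hr hr0
  exact ⟨hx, fun i => r (g i), fun i => ⟨hr _, hr1 _⟩, hanti, hr0.comp hg.tendsto_atTop,
    hconv.comp_strictMono hg⟩

end MMSpace
end

theorem theorem3p2 (X : MMSpace.{u}) (C : ℝ → ℝ) (hC : X.IsBoundedlyDoubling C) :
    ∀ᵐ x ∂X.measure, ∀ Y : PMMSpace.{v}, X.IsTangent x Y →
      ∀ (y' : Y.toMMSpace) (hy' : y' ∈ Y.supp) (W : PMMSpace.{w}),
        (Y.normalize y' hy' 1 one_pos).IsTangent y' W → X.IsTangent x W := by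
  filter_upwards [MMSpace.ae_exists_sat.{u, v, w} hC] with x hx Y hY y' hy' W hW
  exact MMSpace.isTangent_of_forall_sat hC
    (hW.hasTotallyBoundedBalls
      ((hY.hasTotallyBoundedBalls hC.hasTotallyBoundedBalls).normalize y' hy' one_pos))
    hW.integral_cone_eq_one (hx Y hY y' hy' W hW)
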